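/- **Setting.** Let $(Z_{1i},Z_{2i},R_i)$, $i\ge 1$, be i.i.d. copies of $(Z_1,Z_2,R)$ with $Z_1\in\mathbb R^d$, $Z_2\in\mathbb R$, $R\in\{0,1\}$, and suppose the outcome is missing at random: $\Pr(R=1\mid Z_2,Z_1)=\pi_0(Z_1)$ with $\pi_0(Z_1)>0$ a.s. Let $\mathcal B\subset\mathbb R\times(0,\infty)$ be the parameter space of $\beta=(\mu,\sigma)'$ and let $\beta_0=(\mu_0,\sigma_0)'$ be the true value. Let $\psi_{c_\mu},\psi_{c_\sigma}:\mathbb R\to\mathbb R$ be measurable (in robust estimation, bounded and odd), and put $A=E\,\psi_{c_\mu}(\sigma_0^{-1}(Z_2-\mu_0))$, $B=E\,\psi_{c_\sigma}^2(\sigma_0^{-1}(Z_2-\mu_0))$, $$m_\psi(Z_2;\beta)=\big(\psi_{c_\mu}(\sigma^{-1}(Z_2-\mu))-A,\ \psi_{c_\sigma}^2(\sigma^{-1}(Z_2-\mu))-B\big)'.$$ Let $\pi(Z_1;\gamma)>0$, $\gamma\in\mathbb R^p$, be a propensity model and $h(Z_1;\beta,\xi)=(h_1,h_2)'$, $\xi\in\mathbb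 R^q$, a working model for $E(m_\psi(Z_2;\beta)\mid Z_1)$, and define $$\varphi(Z,R;\beta,\gamma,\xi)=\frac{R}{\pi(Z_1;\gamma)}m_\psi(Z_2;\beta)-\frac{R-\pi(Z_1;\gamma)}{\pi(Z_1;\gamma)}h(Z_1;\beta,\xi).$$ Given estimators $\hat\gamma,\hat\xi$, the robust augmented IPW estimator $\hat\beta=(\hat\mu,\hat\sigma)'$ is, with probability tending to one, a minimizer over $\beta\in\mathcal B$ of $\hat Q(\beta;\hat\gamma,\hat\xi)=\big\|n^{-1}\sum_{i=1}^n\varphi(Z_i,R_i;\beta,\hat\gamma,\hat\xi)\big\|^2$ (in particular, a solution in $\mathcal B$ of $\sum_i\varphi(Z_i,R_i;\beta,\hat\gamma,\hat\xi)=0$). All functions are jointly Borel measurable. Assume (A.1) $\hat\gamma\to\gamma^*$ and $\hat\xi\to\xi^*$ in probability, and that at least one model is correctly specified: $\Pr(R=1\mid Z_1)=\pi(Z_1;\gamma^*)$ a.s., or, for every $\beta\in\mathcal B$, $m_\psi(Z_2;\beta)$ is integrable and $h(Z_1;\beta,\xi^*)=E(m_\psi(Z_2;\beta)\mid Z_1)$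 a.s. **(Consistency.)** Suppose in addition: - (A.2) there are open neighbourhoods $U$ of $\gamma^*$ and $V$ of $\xi^*$ such that, almost surely, $\pi(Z_1;\cdot)$ is $C^1$ on $U$ and $h(Z_1;\beta,\cdot)$ is $C^1$ on $V$ for all $\beta\in\mathcal B$, and $E\sup_{\mathcal B\times U\times V}\|\partial\varphi/\partial\gamma'\|<\infty$, $E\sup_{\mathcal B\times U\times V}\|\partial\varphi/\partial\xi'\|<\infty$; - (A.3) $\mathcal B$ is compact, $\beta_0\in\mathcal B$, and $E\,m_\psi(Z_2;\beta)=0$ with $\beta\in\mathcal B$ only for $\beta=\beta_0$; - (A.4) for some $\varepsilon>0$, $1\ge\pi(Z_1;\gamma^*)>\varepsilon$ a.s.; - (A.5)–(A.6) for each $\beta\in\mathcal B$, almost surely $\psi_{c_\mu}(\sigma^{-1}(Z_2-\mu))$, $\psi_{c_\sigma}(\sigma^{-1}(Z_2-\mu))$ and $h(Z_1;\cdot,\xi^*)$ are, as functions on $\mathcal B$, continuous at $\beta$; - (A.7)–(A.8) $\sup_{\beta\in\mathcal B}|\psi_{c_\mu}(\sigma^{-1}(Z_2-\mu))|^2$,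 $\sup_{\beta\in\mathcal B}|\psi_{c_\sigma}^2(\sigma^{-1}(Z_2-\mu))|^2$ and $\sup_{\beta\in\mathcal B}h_j(Z_1;\beta,\xi^*)^2$ $(j=1,2)$ have finite expectation. Then $\hat\beta\to\beta_0$ in probability. **(Asymptotic normality.)** Suppose that $\hat\beta\to\beta_0$ in probability and that, with probability tending to one, $\sum_{i=1}^n m_\gamma(R_i,Z_{1i};\hat\gamma)=0$ and $\sum_{i=1}^nR_i\,m_\xi(Z_i;\hat\xi)=0$, where $m_\gamma$ is $\mathbb R^p$-valued and $m_\xi$ is $\mathbb R^q$-valued. Let $\tilde\varphi(\theta)$, $\theta=(\beta',\gamma',\xi')'$, stack $\varphi(Z,R;\beta,\gamma,\xi)$, $m_\gamma(R,Z_1;\gamma)$ and $R\,m_\xi(Z;\xi)$, put $\theta_0=(\beta_0',\gamma^{*\prime},\xi^{*\prime})'$, and suppose: - (A.9) $\theta_0$ is interior to $\mathcal B\times\mathbb R^p\times\mathbb R^q$; - (A.10) $E\,\tilde\varphi(\theta_0)=0$ and $E\|\tilde\varphi(\theta_0)\|^2<\infty$; - (A.11)–(A.12) there is an open neighbourhood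 $\mathcal N$ of $\theta_0$ on which $\tilde\varphi$ is a.s. $C^1$, with $E\sup_{\theta\in\mathcal N}\|\nabla_\theta\tilde\varphi(\theta)\|<\infty$; - (A.13) $E\{\nabla_\theta\tilde\varphi(\theta_0)\}'E\{\nabla_\theta\tilde\varphi(\theta_0)\}$ is nonsingular; - $m_\psi(Z_2;\cdot)$ is a.s. differentiable at $\beta_0$ with integrable derivative (so that the expectation below exists). Then $\sqrt n(\hat\beta-\beta_0)\overset{d}\to N\big(0,E[IF\,IF']\big)$, where, with all derivatives taken at $(\beta_0,\gamma^*,\xi^*)$, $$IF=-\Big\{E\Big[\frac{\partial m_\psi}{\partial\beta'}\Big]\Big\}^{-1}\Big\{\varphi(Z,R;\beta_0,\gamma^*,\xi^*)-E\Big[\frac{\partial\varphi}{\partial\gamma'}\Big]\Big\{E\Big[\frac{\partial m_\gamma}{\partial\gamma'}\Big]\Big\}^{-1}m_\gamma(R,Z_1;\gamma^*)-E\Big[\frac{\partial\varphi}{\partial\xi'}\Big]\Big\{E\Big[R\frac{\partial m_\xi}{\partial\xi'}\Big]\Big\}^{-1}R\,m_\xi(Z;\xi^*)\Big\}.$$ 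-/

import Mathlib

open MeasureTheory ProbabilityTheory Filter Topology

noncomputable section

namespace RobustAIPW

/-- `ℝᵏ` with its Euclidean norm. -/
abbrev Vec (k : ℕ) : Type := EuclideanSpace ℝ (Fin k)

/-- One complete observation `(Z₁, Z₂, R)`: covariate vector, scalar outcome, observation status. -/
abbrev Obs (d : ℕ) : Type := (Fin d → ℝ) × ℝ × Bool

/-- The covariates `Z₁`. -/
def z1 {d : ℕ} (o : Obs d) : Fin d → ℝ := o.1

/-- The outcome `Z₂`. -/
def z2 {d : ℕ} (o : Obs d) : ℝ := o.2.1

/-- The observation indicator `R`, as a number in `{0, 1}`. -/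
def rInd {d : ℕ} (o : Obs d) : ℝ := if o.2.2 then 1 else 0

/-- The σ-algebra generated by `Z₁`. -/
abbrev sigmaZ1 (d : ℕ) : MeasurableSpace (Obs d) := MeasurableSpace.comap z1 inferInstance

/-- The σ-algebra generated by `(Z₁, Z₂)`. -/
abbrev sigmaZ (d : ℕ) : MeasurableSpace (Obs d) :=
  MeasurableSpace.comap (fun o => (z1 o, z2 o)) inferInstance

/-- The ingredients chosen by the statistician. The parameter of interest is `β = (μ, σ) : Vec 2`,
with `β 0 = μ` and `β 1 = σ`; the nuisance parameters are `γ : Vec p` and `ξ : Vec q`. -/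
structure Ingredients (d p q : ℕ) where
  /-- the family `c ↦ ψ_c` -/
  psi : ℝ → ℝ → ℝ
  /-- tuning constant for the location equation -/
  cMu : ℝ
  /-- tuning constant for the scale equation -/
  cSigma : ℝ
  /-- propensity model `π(Z₁; γ)` -/
  prop : (Fin d → ℝ) → Vec p → ℝ
  /-- outcome working model `h(Z₁; β, ξ) = (h₁, h₂)` -/
  h : (Fin d → ℝ) → Vec 2 → Vec q → Vec 2
  /-- estimating function `m_γ(R, Z₁; γ)` -/
  mGamma : Bool → (Fin d → ℝ) → Vec p → Vec p
  /-- estimating function `m_ξ(Z; ξ)`, which is used only for observations with `R = 1` -/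
  mXi : (Fin d → ℝ) → ℝ → Vec q → Vec q
  measurable_psiMu : Measurable (psi cMu)
  measurable_psiSigma : Measurable (psi cSigma)
  measurable_prop : Measurable fun x : (Fin d → ℝ) × Vec p => prop x.1 x.2
  measurable_h : Measurable fun x : (Fin d → ℝ) × Vec 2 × Vec q => h x.1 x.2.1 x.2.2
  measurable_mGamma : Measurable fun x : Bool × (Fin d → ℝ) × Vec p => mGamma x.1 x.2.1 x.2.2
  measurable_mXi : Measurable fun x : (Fin d → ℝ) × ℝ × Vec q => mXi x.1 x.2.1 x.2.2
  prop_pos : ∀ z γ, 0 < prop z γ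

variable {d p q : ℕ}

/-- Missing at random: `Pr(R = 1 ∣ Z₂, Z₁) = π(Z₁)` with `π(Z₁) > 0`. -/
def MissingAtRandom (P : Measure (Obs d)) : Prop :=
  ∃ π₀ : (Fin d → ℝ) → ℝ, Measurable π₀ ∧ (∀ᵐ o ∂P, 0 < π₀ (z1 o)) ∧
    P[rInd | sigmaZ d] =ᵐ[P] fun o => π₀ (z1 o)

/-- `A = E ψ_{c_μ}((Z₂ - μ₀)/σ₀)`. -/
def constA (M : Ingredients d p q) (P : Measure (Obs d)) (β₀ : Vec 2) : ℝ :=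
  ∫ o, M.psi M.cMu ((z2 o - β₀ 0) / β₀ 1) ∂P

/-- `B = E ψ_{c_σ}²((Z₂ - μ₀)/σ₀)`. -/
def constB (M : Ingredients d p q) (P : Measure (Obs d)) (β₀ : Vec 2) : ℝ :=
  ∫ o, (M.psi M.cSigma ((z2 o - β₀ 0) / β₀ 1)) ^ 2 ∂P

/-- The full-data estimating function `m_ψ(Z₂; β)`. -/
def mPsi (M : Ingredients d p q) (P : Measure (Obs d)) (β₀ : Vec 2) (o : Obs d) (β : Vec 2) :
    Vec 2 :=
  !₂[M.psi M.cMu ((z2 o - β 0) / β 1) - constA M P β₀,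
    (M.psi M.cSigma ((z2 o - β 0) / β 1)) ^ 2 - constB M P β₀]

/-- The estimating function `φ_RAIPW(Z, R; β, γ, ξ)`. -/
def phi (M : Ingredients d p q) (P : Measure (Obs d)) (β₀ : Vec 2) (o : Obs d)
    (β : Vec 2) (γ : Vec p) (ξ : Vec q) : Vec 2 :=
  (rInd o / M.prop (z1 o) γ) • mPsi M P β₀ o β
    - ((rInd o - M.prop (z1 o) γ) / M.prop (z1 o) γ) • M.h (z1 o) β ξ

/-- `m_γ(R, Z₁; γ)` at an observation. -/
def obsMGamma (M : Ingredients d p q) (o : Obs d) (γ : Vec p) : Vec p :=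
  M.mGamma o.2.2 (z1 o) γ

/-- `R m_ξ(Z; ξ)` at an observation. -/
def obsMXi (M : Ingredients d p q) (o : Obs d) (ξ : Vec q) : Vec q :=
  rInd o • M.mXi (z1 o) (z2 o) ξ

/-- The propensity model is correctly specified at `γ`: `Pr(R = 1 ∣ Z₁) = π(Z₁; γ)`. -/
def PropensityCorrect (M : Ingredients d p q) (P : Measure (Obs d)) (γ : Vec p) : Prop :=
  P[rInd | sigmaZ1 d] =ᵐ[P] fun o => M.prop (z1 o) γ

/-- The working model is correctly specified at `ξ`: `h(Z₁; β, ξ) = E(m_ψ(Z₂; β) ∣ Z₁)` for every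
`β` in the parameter space. -/
def OutcomeCorrect (M : Ingredients d p q) (P : Measure (Obs d)) (β₀ : Vec 2)
    (B : Set (Vec 2)) (ξ : Vec q) : Prop :=
  ∀ β ∈ B, Integrable (fun o => mPsi M P β₀ o β) P ∧
    P[fun o => mPsi M P β₀ o β | sigmaZ1 d] =ᵐ[P] fun o => M.h (z1 o) β ξ

/-- `E (sup_{s ∈ S} f(O, s)) < ∞` for a nonnegative `f`, expressed through an integrable
majorant so that measurability of the supremum is not an issue. -/
def FiniteExpectedSup {α : Type*} (P : Measure (Obs d)) (S : Set α) (f : Obs d → α → ℝ) : Prop :=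
  ∃ G : Obs d → ℝ, Integrable G P ∧ ∀ᵐ o ∂P, ∀ s ∈ S, f o s ≤ G o

/-- Regularity conditions for consistency (beyond convergence of the nuisance estimators). -/
structure ConsistencyConditions (M : Ingredients d p q) (P : Measure (Obs d)) (β₀ : Vec 2)
    (γs : Vec p) (ξs : Vec q) (B : Set (Vec 2)) : Prop where
  /-- `π` and `h` are continuously differentiable in the nuisance parameters near their limits, and
  the derivatives of `φ` in the nuisance parameters have an integrable supremum over `β ∈ B` and
  over the nuisance parameters near their limits. -/
  smooth_nuisance : ∃ U : Set (Vec p), ∃ V : Set (Vec q),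
    IsOpen U ∧ γs ∈ U ∧ IsOpen V ∧ ξs ∈ V ∧
    (∀ᵐ o ∂P, ContDiffOn ℝ 1 (M.prop (z1 o)) U) ∧
    (∀ᵐ o ∂P, ∀ β ∈ B, ContDiffOn ℝ 1 (M.h (z1 o) β) V) ∧
    FiniteExpectedSup P (B ×ˢ U ×ˢ V)
      (fun o x => ‖fderiv ℝ (fun γ => phi M P β₀ o x.1 γ x.2.2) x.2.1‖) ∧
    FiniteExpectedSup P (B ×ˢ U ×ˢ V)
      (fun o x => ‖fderiv ℝ (fun ξ => phi M P β₀ o x.1 x.2.1 ξ) x.2.2‖)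
  compact : IsCompact B
  mem : β₀ ∈ B
  identification : ∀ β ∈ B, ∫ o, mPsi M P β₀ o β ∂P = 0 → β = β₀
  overlap : ∃ ε : ℝ, 0 < ε ∧ ∀ᵐ o ∂P, ε < M.prop (z1 o) γs ∧ M.prop (z1 o) γs ≤ 1
  continuous_psi : ∀ β ∈ B, ∀ᵐ o ∂P,
    ContinuousWithinAt (fun b : Vec 2 => M.psi M.cMu ((z2 o - b 0) / b 1)) B β ∧
    ContinuousWithinAt (fun b : Vec 2 => M.psi M.cSigma ((z2 o - b 0) / b 1)) B β
  continuous_h : ∀ β ∈ B, ∀ᵐ o ∂P, ContinuousWithinAt (fun b => M.h (z1 o) b ξs) B β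
  moment_psiMu : FiniteExpectedSup P B
    (fun o β => |M.psi M.cMu ((z2 o - β 0) / β 1)| ^ 2)
  moment_psiSigma : FiniteExpectedSup P B
    (fun o β => |(M.psi M.cSigma ((z2 o - β 0) / β 1)) ^ 2| ^ 2)
  moment_h : ∀ j : Fin 2, FiniteExpectedSup P B (fun o β => (M.h (z1 o) β ξs j) ^ 2)

/-- The space of `θ = (μ, σ, γ', ξ')'`. -/
abbrev Theta (p q : ℕ) : Type := EuclideanSpace ℝ (Fin 2 ⊕ Fin p ⊕ Fin q)

/-- Stacking three vectors. -/
def stack (β : Vec 2) (γ : Vec p) (ξ : Vec q) : Theta p q :=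
  WithLp.toLp 2 (Sum.elim β (Sum.elim γ ξ))

/-- The `(μ, σ)` block of `θ`. -/
def betaPart (θ : Theta p q) : Vec 2 := WithLp.toLp 2 fun i => θ (Sum.inl i)

/-- The `γ` block of `θ`. -/
def gammaPart (θ : Theta p q) : Vec p := WithLp.toLp 2 fun i => θ (Sum.inr (Sum.inl i))

/-- The `ξ` block of `θ`. -/
def xiPart (θ : Theta p q) : Vec q := WithLp.toLp 2 fun i => θ (Sum.inr (Sum.inr i))

/-- The stacked estimating function `φ̃(θ)`. -/
def phiTilde (M : Ingredients d p q) (P : Measure (Obs d)) (β₀ : Vec 2) (o : Obs d)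
    (θ : Theta p q) : Theta p q :=
  stack (phi M P β₀ o (betaPart θ) (gammaPart θ) (xiPart θ))
    (obsMGamma M o (gammaPart θ)) (obsMXi M o (xiPart θ))

/-- The Jacobian matrix `∂f/∂x'`. -/
def jacobian {ι κ : Type*} [Fintype ι] [DecidableEq ι] [Fintype κ]
    (f : EuclideanSpace ℝ ι → EuclideanSpace ℝ κ) (x : EuclideanSpace ℝ ι) : Matrix κ ι ℝ :=
  Matrix.of fun k i => fderiv ℝ f x (EuclideanSpace.single i 1) k

/-- The expected Jacobian matrix `E[∂f(O; x)/∂x']`. -/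
def expJacobian {ι κ : Type*} [Fintype ι] [DecidableEq ι] [Fintype κ] (P : Measure (Obs d))
    (f : Obs d → EuclideanSpace ℝ ι → EuclideanSpace ℝ κ) (x : EuclideanSpace ℝ ι) :
    Matrix κ ι ℝ :=
  Matrix.of fun k i => ∫ o, jacobian (f o) x k i ∂P

/-- Regularity conditions for asymptotic normality. The parameter space of `θ` is
`B × ℝᵖ × ℝ^q`. -/
structure NormalityConditions (M : Ingredients d p q) (P : Measure (Obs d)) (β₀ : Vec 2)
    (γs : Vec p) (ξs : Vec q) (B : Set (Vec 2)) : Prop where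
  interior_mem : stack β₀ γs ξs ∈ interior {θ : Theta p q | betaPart θ ∈ B}
  mean_zero : ∫ o, phiTilde M P β₀ o (stack β₀ γs ξs) ∂P = 0
  second_moment : MemLp (fun o => phiTilde M P β₀ o (stack β₀ γs ξs)) 2 P
  smooth : ∃ N : Set (Theta p q), IsOpen N ∧ stack β₀ γs ξs ∈ N ∧
    (∀ᵐ o ∂P, ContDiffOn ℝ 1 (phiTilde M P β₀ o) N) ∧
    FiniteExpectedSup P N (fun o θ => ‖fderiv ℝ (phiTilde M P β₀ o) θ‖)
  nonsingular : IsUnit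
    ((expJacobian P (phiTilde M P β₀) (stack β₀ γs ξs)).transpose *
      expJacobian P (phiTilde M P β₀) (stack β₀ γs ξs))
  /-- The expectation `E[∂m_ψ(Z₂; β₀)/∂β']` exists. -/
  differentiable_mPsi : ∀ᵐ o ∂P, DifferentiableAt ℝ (mPsi M P β₀ o) β₀
  integrable_mPsi : ∀ k i, Integrable (fun o => jacobian (mPsi M P β₀ o) β₀ k i) P

/-- The influence function of the robust augmented IPW estimator. -/
def influence (M : Ingredients d p q) (P : Measure (Obs d)) (β₀ : Vec 2)
    (γs : Vec p) (ξs : Vec q) (o : Obs d) : Vec 2 :=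
  WithLp.toLp 2 <|
    -((expJacobian P (mPsi M P β₀) β₀)⁻¹.mulVec
      ((phi M P β₀ o β₀ γs ξs).ofLp
        - (expJacobian P (fun o γ => phi M P β₀ o β₀ γ ξs) γs).mulVec
            ((expJacobian P (obsMGamma M) γs)⁻¹.mulVec (obsMGamma M o γs).ofLp)
        - (expJacobian P (fun o ξ => phi M P β₀ o β₀ γs ξ) ξs).mulVec
            ((expJacobian P (obsMXi M) ξs)⁻¹.mulVec (obsMXi M o ξs).ofLp)))

/-- The asymptotic variance `E[IF IF']`. -/
def asymptoticVariance (M : Ingredients d p q) (P : Measure (Obs d)) (β₀ : Vec 2)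
    (γs : Vec p) (ξs : Vec q) : Matrix (Fin 2) (Fin 2) ℝ :=
  Matrix.of fun a b => ∫ o, influence M P β₀ γs ξs o a * influence M P β₀ γs ξs o b ∂P

/-- The criterion `Q̂(β; γ, ξ) = n⁻² (∑ φᵢ)'(∑ φᵢ)` of the sample `o₀, …, o_{n-1}`. -/
def Qhat (M : Ingredients d p q) (P : Measure (Obs d)) (β₀ : Vec 2) (n : ℕ) (o : ℕ → Obs d)
    (β : Vec 2) (γ : Vec p) (ξ : Vec q) : ℝ :=
  ((n : ℝ) ^ 2)⁻¹ * ‖∑ i ∈ Finset.range n, phi M P β₀ (o i) β γ ξ‖ ^ 2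

/-- The event `p n` has probability tending to one. -/
def EventuallyLikely {Ω : Type*} [MeasurableSpace Ω] (Pr : Measure Ω) (p : ℕ → Ω → Prop) : Prop :=
  Tendsto (fun n => Pr {ω | ¬ p n ω}) atTop (𝓝 0)

end RobustAIPW

end

/-! Double robustness drives both halves. On `R = 1` the estimating function is `(m - (1 - π) h) /
π`, on `R = 0` it is `h`. Under missingness at random, conditioning on `Z₁` gives `π E[R φ ∣ Z₁] =
π₀ (E[m ∣ Z₁] - (1 - π) h)` and `E[(1 - R) φ ∣ Z₁] = (1 - π₀) h`. If `π = π₀`, or if `h = E[m ∣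
Z₁]`, the two pieces add up to `E[m ∣ Z₁]`, so `φ` and `m` have the same mean. The argument is
carried out for almost sure limits of linear combinations
(`integral_limit_phi_eq_integral_limit_mPsi`), since it is used twice: with a constant sequence for
the means, and with difference quotients in `β` for the expected derivatives.

Consistency is the usual argument for extremum estimators. Replacing the estimated nuisance
parameters by their limits costs little uniformly in `β` (mean value inequality). A uniform law of
large numbers then makes the average of `φ` close to `E m`, and by compactness and identification `E
m` is bounded away from zero outside any neighbourhood of `β₀`.

For normality, the averaged stacked function is, near `θ₀`, strictly differentiable up to a small
error with derivative the expected Jacobian `J` (`eventuallyLikely_average_strict_fderiv`). A Newton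
step from the estimator changes only `β` and would lower the criterion unless the estimating
equations already hold; so a minimizer solves them with probability tending to one. Linearization
gives `√n (θ̂ - θ₀) = -J⁻¹ √n (average at θ₀) + o_P(1)`. As `J` is block upper triangular, with the
expected derivative of `m` in its `β` block, the first block of `-J⁻¹ φ̃` is the influence function,
and the central limit theorem with Slutsky's lemma concludes.

Suprema over uncountable parameter sets occur in both laws of large numbers. Their measurability
comes from the measurable projection theorem, obtained here from the universal measurability of
analytic sets. -/

namespace RobustAIPW

/-! ### Analytic sets, measurable projection, and suprema over uncountable families. -/

section AnalyticSets

open Set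

/-- A finite measure of a continuous image of Baire space is approximated from inside by compact
sets. -/
theorem exists_isCompact_subset_range_le_measure {α : Type*} [TopologicalSpace α]
    [MeasurableSpace α] [BorelSpace α] (μ : Measure α) [μ.OuterRegular] {f : (ℕ → ℕ) → α}
    (hf : Continuous f) {c : ENNReal} (hc : c < μ (range f)) :
    ∃ K ⊆ range f, IsCompact K ∧ c ≤ μ K := by
  -- Bounding one more coordinate loses arbitrarily little measure. The images need not be
  -- measurable, but continuity along increasing unions holds for arbitrary sets.
  have step : ∀ (n : ℕ) (S : Set (ℕ → ℕ)), ∃ m : ℕ, c < μ (f '' S) →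
      c < μ (f '' (S ∩ {x | x n ≤ m})) := by
    intro n S
    by_cases h : c < μ (f '' S)
    · have hU : f '' S = ⋃ m : ℕ, f '' (S ∩ {x | x n ≤ m}) := by
        rw [← image_iUnion, ← inter_iUnion]
        congr 1
        symm
        rw [inter_eq_left]
        exact fun x _ => mem_iUnion.2 ⟨x n, le_refl (x n)⟩
      have hmono : Monotone fun m : ℕ => f '' (S ∩ {x | x n ≤ m}) := fun a b hab =>
        image_mono (inter_subset_inter_right _ fun x (hx : x n ≤ a) => hx.trans hab)
      rw [hU, hmono.measure_iUnion, lt_iSup_iff] at h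
      obtain ⟨m, hm⟩ := h
      exact ⟨m, fun _ => hm⟩
    · exact ⟨0, fun h' => absurd h' h⟩
  choose m hm using step
  let S : ℕ → Set (ℕ → ℕ) := fun n => Nat.rec univ (fun n T => T ∩ {x | x n ≤ m n T}) n
  have hSc : ∀ n, c < μ (f '' S n) := by
    intro n
    induction n with
    | zero => simpa [S] using hc
    | succ n ih => exact hm n _ ih
  let k : ℕ → ℕ := fun n => m n (S n)
  have hS : ∀ n x, x ∈ S n → ∀ i < n, x i ≤ k i := by
    intro n
    induction n with
    | zero => intro x _ i hi; omega
    | succ n ih =>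
      intro x hx i hi
      rcases Nat.lt_succ_iff_lt_or_eq.1 hi with h | rfl
      · exact ih x hx.1 i h
      · exact hx.2
  have hcomp : ∀ b : ℕ → ℕ, IsCompact {x : ℕ → ℕ | ∀ i, x i ≤ b i} := by
    intro b
    have : {x : ℕ → ℕ | ∀ i, x i ≤ b i} = Set.pi univ fun i => Iic (b i) := by
      ext; simp [Pi.le_def]
    rw [this]
    exact isCompact_univ_pi fun i => (finite_Iic (b i)).isCompact
  refine ⟨f '' {x | ∀ i, x i ≤ k i}, image_subset_range _ _, (hcomp k).image hf, ?_⟩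
  -- By outer regularity it is enough to treat an open `U` containing the compact image: some `S n`
  -- is already mapped into `U`, and its image has measure above `c`.
  rw [Set.measure_eq_iInf_isOpen]
  refine le_iInf₂ fun U hKU => le_iInf fun hU => ?_
  suffices h : ∃ n, S n ⊆ f ⁻¹' U by
    obtain ⟨n, hn⟩ := h
    exact (hSc n).le.trans (measure_mono (image_subset_iff.2 hn))
  by_contra hcon
  choose x hxS hxU using fun n => not_subset.1 (not_exists.1 hcon n)
  -- Only the terms `n ≤ i` can exceed `k i` in coordinate `i`, so the whole sequence lies in a
  -- compact box. A cluster point lies in the smaller box given by `k`, hence is mapped into `U`,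
  -- although no term of the sequence is.
  let b : ℕ → ℕ := fun i => max (k i) ((Finset.range (i + 1)).sup fun n => x n i)
  have hxb : ∀ n, x n ∈ {x : ℕ → ℕ | ∀ i, x i ≤ b i} := by
    intro n i
    rcases lt_or_ge i n with h | h
    · exact (hS n _ (hxS n) i h).trans (le_max_left _ _)
    · exact le_trans (Finset.le_sup (f := fun n => x n i) (Finset.mem_range.2 (by omega)))
        (le_max_right _ _)
  obtain ⟨a, -, φ, hφ, hlim⟩ := (hcomp b).tendsto_subseq hxb
  have haU : a ∈ (f ⁻¹' U)ᶜ :=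
    (hU.preimage hf).isClosed_compl.mem_of_tendsto hlim (Eventually.of_forall fun n => hxU (φ n))
  refine haU (hKU ⟨a, fun i => ?_, rfl⟩)
  have hi : Tendsto (fun n => x (φ n) i) atTop (𝓝 (a i)) :=
    ((continuous_apply i).tendsto a).comp hlim
  refine le_of_tendsto hi ?_
  filter_upwards [eventually_gt_atTop i] with n hn
  exact hS _ _ (hxS (φ n)) i (hn.trans_le (hφ.id_le n))

/-- Analytic sets are universally measurable. -/
theorem AnalyticSet.nullMeasurableSet {α : Type*} [TopologicalSpace α] [T2Space α]
    [MeasurableSpace α] [BorelSpace α] (μ : Measure α) [IsFiniteMeasure μ] [μ.OuterRegular]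
    {s : Set α} (hs : AnalyticSet s) : NullMeasurableSet s μ := by
  rw [AnalyticSet] at hs
  rcases hs with rfl | ⟨f, hf, rfl⟩
  · exact nullMeasurableSet_empty
  by_cases h0 : μ (range f) = 0
  · exact NullMeasurableSet.of_null h0
  obtain ⟨c, -, hc, hclim⟩ := exists_seq_strictMono_tendsto' (pos_iff_ne_zero.2 h0)
  choose K hKs hK hcK using fun n =>
    exists_isCompact_subset_range_le_measure μ hf (hc n).2
  have hUm : MeasurableSet (⋃ n, K n) := MeasurableSet.iUnion fun n => (hK n).measurableSet
  have hUs : (⋃ n, K n) ⊆ range f := iUnion_subset hKs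
  have hle : μ (range f) ≤ μ (⋃ n, K n) :=
    le_of_tendsto' hclim fun n => (hcK n).trans (measure_mono (subset_iUnion K n))
  exact ⟨⋃ n, K n, hUm, ((ae_eq_of_subset_of_measure_ge hUs hle hUm.nullMeasurableSet
    (measure_ne_top _ _))).symm⟩

/-- For compatible Polish topologies, the projection of a Borel set is a continuous image of an
analytic set, hence analytic. -/
theorem nullMeasurableSet_image_fst {α β : Type*} [MeasurableSpace α] [StandardBorelSpace α]
    [MeasurableSpace β] [StandardBorelSpace β] (μ : Measure α) [IsFiniteMeasure μ]
    {s : Set (α × β)} (hs : MeasurableSet s) : NullMeasurableSet (Prod.fst '' s) μ := by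
  let _ := upgradeStandardBorel α
  let _ := upgradeStandardBorel β
  exact AnalyticSet.nullMeasurableSet μ (hs.analyticSet.image_of_continuous continuous_fst)

/-- A strict superlevel set of the supremum is the projection of a measurable subset of the product,
so `S` may be uncountable. -/
theorem aemeasurable_biSup_of_measurable_prod {α β : Type*} [MeasurableSpace α]
    [StandardBorelSpace α] [MeasurableSpace β] [StandardBorelSpace β] (μ : Measure α)
    [IsFiniteMeasure μ] {g : α × β → ENNReal} (hg : Measurable g) {S : Set β}
    (hS : MeasurableSet S) : AEMeasurable (fun a => ⨆ b ∈ S, g (a, b)) μ := by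
  refine NullMeasurable.aemeasurable ?_
  refine measurable_of_Ioi (α := ENNReal) (δ := NullMeasurableSpace α μ) fun c => ?_
  have : (fun a => ⨆ b ∈ S, g (a, b)) ⁻¹' Ioi c
      = Prod.fst '' ({x : α × β | c < g x} ∩ Prod.snd ⁻¹' S) := by
    ext a
    simp only [mem_preimage, mem_Ioi, lt_iSup_iff, mem_image, mem_inter_iff, mem_ofPred_eq,
      Prod.exists, exists_and_right, exists_eq_right, exists_prop]
    exact ⟨fun ⟨b, hb, h⟩ => ⟨b, h, hb⟩, fun ⟨b, h, hb⟩ => ⟨b, hb, h⟩⟩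
  exact this ▸ nullMeasurableSet_image_fst μ
    ((measurableSet_lt measurable_const hg).inter (measurable_snd hS))

/-- If a jointly measurable function has an integrable envelope and becomes uniformly small on a
decreasing sequence of sets, then its supremum over these sets becomes small in mean. -/
theorem exists_integrable_majorant_integral_lt {α β : Type*} [MeasurableSpace α]
    [StandardBorelSpace α] [MeasurableSpace β] [StandardBorelSpace β] (μ : Measure α)
    [IsFiniteMeasure μ] {g : α → β → ℝ} (hg : Measurable fun x : α × β => g x.1 x.2)
    {S : ℕ → Set β} (hS : ∀ k, MeasurableSet (S k)) (hanti : Antitone S) {G : α → ℝ}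
    (hG : Integrable G μ) (hgG : ∀ᵐ a ∂μ, ∀ b ∈ S 0, g a b ≤ G a)
    (hlim : ∀ᵐ a ∂μ, ∀ ε > 0, ∃ k, ∀ b ∈ S k, g a b ≤ ε) {ε : ℝ} (hε : 0 < ε) :
    ∃ k, ∃ ρ : α → ℝ, Integrable ρ μ ∧ ∫ a, ρ a ∂μ < ε ∧ ∀ᵐ a ∂μ, ∀ b ∈ S k, g a b ≤ ρ a := by
  -- Truncating at zero in `ENNReal` gives the supremum a meaning even when `S k` is empty or `g` is
  -- unbounded; dominated convergence then applies with the envelope `G`.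
  let s : ℕ → α → ENNReal := fun k a => ⨆ b ∈ S k, ENNReal.ofReal (g a b)
  have hs : ∀ k, AEMeasurable (s k) μ := fun k =>
    aemeasurable_biSup_of_measurable_prod μ (g := fun x => ENNReal.ofReal (g x.1 x.2))
      hg.ennreal_ofReal (hS k)
  have hsG : ∀ k, ∀ᵐ a ∂μ, s k a ≤ ENNReal.ofReal (G a) := by
    intro k
    filter_upwards [hgG] with a ha
    exact iSup₂_le fun b hb => ENNReal.ofReal_le_ofReal (ha b (hanti (Nat.zero_le k) hb))
  have hGfin : ∫⁻ a, ENNReal.ofReal (G a) ∂μ ≠ ⊤ := hG.lintegral_lt_top.ne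
  have htend : Tendsto (fun k => ∫⁻ a, s k a ∂μ) atTop (𝓝 (∫⁻ _, 0 ∂μ)) := by
    refine tendsto_lintegral_of_dominated_convergence' _ hs hsG hGfin ?_
    filter_upwards [hlim] with a ha
    rw [ENNReal.tendsto_nhds_zero]
    intro η hη
    by_cases hη' : η = ⊤
    · simp [hη']
    obtain ⟨k, hk⟩ := ha η.toReal (ENNReal.toReal_pos hη.ne' hη')
    filter_upwards [eventually_ge_atTop k] with j hj
    refine iSup₂_le fun b hb => ?_
    rw [← ENNReal.ofReal_toReal hη']
    exact ENNReal.ofReal_le_ofReal (hk b (hanti hj hb))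
  rw [lintegral_zero] at htend
  obtain ⟨k, hk⟩ := (htend.eventually_lt_const (ENNReal.ofReal_pos.2 hε)).exists
  have hfin : ∀ᵐ a ∂μ, s k a < ⊤ := by
    filter_upwards [hsG k] with a ha using ha.trans_lt ENNReal.ofReal_lt_top
  refine ⟨k, fun a => (s k a).toReal, integrable_toReal_of_lintegral_ne_top (hs k)
    (hk.trans ENNReal.ofReal_lt_top).ne, ?_, ?_⟩
  · rw [integral_toReal (hs k) hfin]
    exact (ENNReal.lt_ofReal_iff_toReal_lt (hk.trans ENNReal.ofReal_lt_top).ne).1 hk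
  · filter_upwards [hfin] with a ha b hb
    rw [← ENNReal.ofReal_le_iff_le_toReal ha.ne]
    exact le_iSup₂ (f := fun b (_ : b ∈ S k) => ENNReal.ofReal (g a b)) b hb

end AnalyticSets

/-! ### Calculus of events of probability tending to one. -/

section Likely

variable {Ω : Type*} [MeasurableSpace Ω] {Pr : Measure Ω}

/-- Only monotonicity of the measure on arbitrary sets is used, so the events in this calculus need
not be measurable. -/
theorem EventuallyLikely.mono {p r : ℕ → Ω → Prop} (hp : EventuallyLikely Pr p)
    (h : ∀ᶠ n in atTop, ∀ᵐ ω ∂Pr, p n ω → r n ω) : EventuallyLikely Pr r := by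
  refine tendsto_of_tendsto_of_tendsto_of_le_of_le' tendsto_const_nhds hp
    (Eventually.of_forall fun _ => zero_le) ?_
  filter_upwards [h] with n hn
  refine measure_mono_ae ?_
  filter_upwards [hn] with ω hω using fun hr hp => hr (hω hp)

theorem EventuallyLikely.and {p r : ℕ → Ω → Prop} (hp : EventuallyLikely Pr p)
    (hr : EventuallyLikely Pr r) : EventuallyLikely Pr fun n ω => p n ω ∧ r n ω := by
  have hpr := hp.add hr
  rw [add_zero] at hpr
  refine tendsto_of_tendsto_of_tendsto_of_le_of_le tendsto_const_nhds hpr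
    (fun _ => zero_le) fun n => ?_
  refine le_trans (measure_mono fun ω hω => ?_) (measure_union_le _ _)
  simpa [not_and_or, or_iff_not_imp_left] using hω

theorem eventuallyLikely_of_ae {p : ℕ → Ω → Prop} (h : ∀ᶠ n in atTop, ∀ᵐ ω ∂Pr, p n ω) :
    EventuallyLikely Pr p := by
  refine tendsto_const_nhds.congr' ?_
  filter_upwards [h] with n hn using (ae_iff.1 hn).symm

theorem EventuallyLikely.finset_forall {ι : Type*} (t : Finset ι) {p : ι → ℕ → Ω → Prop}
    (hp : ∀ j ∈ t, EventuallyLikely Pr (p j)) :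
    EventuallyLikely Pr fun n ω => ∀ j ∈ t, p j n ω := by
  classical
  induction t using Finset.induction_on with
  | empty => exact eventuallyLikely_of_ae (by simp)
  | insert a t _ ih =>
    refine ((hp a (by simp)).and (ih fun j hj => hp j (by simp [hj]))).mono
      (Eventually.of_forall fun n => ae_of_all _ fun ω h => ?_)
    simpa using h

theorem eventuallyLikely_norm_sub_lt {E : Type*} [SeminormedAddCommGroup E] {X : ℕ → Ω → E} {c : E}
    (h : TendstoInMeasure Pr X atTop fun _ => c) {ε : ℝ} (hε : 0 < ε) :
    EventuallyLikely Pr fun n ω => ‖X n ω - c‖ < ε := by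
  rw [tendstoInMeasure_iff_norm] at h
  simpa [EventuallyLikely] using h ε hε

theorem tendstoInMeasure_of_eventuallyLikely {E : Type*} [SeminormedAddCommGroup E]
    {X : ℕ → Ω → E} {c : E} (h : ∀ ε > 0, EventuallyLikely Pr fun n ω => ‖X n ω - c‖ < ε) :
    TendstoInMeasure Pr X atTop fun _ => c := by
  rw [tendstoInMeasure_iff_norm]
  intro ε hε
  simpa [EventuallyLikely] using h ε hε

end Likely

/-! ### Law of large numbers and central limit theorem for functions of the sample. -/

section Sample

variable {Ω α : Type*} [MeasurableSpace Ω] [MeasurableSpace α] {Pr : Measure Ω}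
  {P : Measure α} {O : ℕ → Ω → α}

theorem ae_forall_sample (hlaw : ∀ i, HasLaw (O i) P Pr) {p : α → Prop} (hp : ∀ᵐ o ∂P, p o) :
    ∀ᵐ ω ∂Pr, ∀ i, p (O i ω) := by
  rw [ae_all_iff]
  intro i
  rw [← (hlaw i).map_eq] at hp
  exact ae_of_ae_map (hlaw i).aemeasurable hp

theorem identDistrib_comp_sample (hlaw : ∀ i, HasLaw (O i) P Pr) {E : Type*} [MeasurableSpace E]
    {f : α → E} (hf : AEMeasurable f P) (i j : ℕ) :
    IdentDistrib (fun ω => f (O i ω)) (fun ω => f (O j ω)) Pr Pr := by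
  have h : IdentDistrib (O i) (O j) Pr Pr :=
    ⟨(hlaw i).aemeasurable, (hlaw j).aemeasurable, by rw [(hlaw i).map_eq, (hlaw j).map_eq]⟩
  exact h.comp_of_aemeasurable (u := f) (by rwa [(hlaw i).map_eq])

theorem iIndepFun_comp_sample (hlaw : ∀ i, HasLaw (O i) P Pr) (hindep : iIndepFun O Pr)
    {E : Type*} [MeasurableSpace E] {f : α → E} (hf : AEMeasurable f P) :
    iIndepFun (fun i ω => f (O i ω)) Pr :=
  hindep.comp₀ (fun _ => f) (fun i => (hlaw i).aemeasurable) fun i => by rwa [(hlaw i).map_eq]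

/-- Weak law of large numbers. -/
theorem eventuallyLikely_average [IsFiniteMeasure Pr] (hlaw : ∀ i, HasLaw (O i) P Pr)
    (hindep : iIndepFun O Pr)
    {E : Type*} [NormedAddCommGroup E] [NormedSpace ℝ E] [CompleteSpace E] [MeasurableSpace E]
    [BorelSpace E] {f : α → E} (hf : Integrable f P) {ε : ℝ} (hε : 0 < ε) :
    EventuallyLikely Pr fun n ω =>
      ‖(n : ℝ)⁻¹ • ∑ i ∈ Finset.range n, f (O i ω) - ∫ o, f o ∂P‖ < ε := by
  have hfm : AEStronglyMeasurable f (Pr.map (O 0)) := by rw [(hlaw 0).map_eq]; exact hf.1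
  have hInt : ∀ i, Integrable (fun ω => f (O i ω)) Pr := fun i =>
    Integrable.comp_aemeasurable (by rwa [(hlaw i).map_eq]) (hlaw i).aemeasurable
  have hmean : ∫ ω, f (O 0 ω) ∂Pr = ∫ o, f o ∂P := by
    rw [← (hlaw 0).map_eq, integral_map (hlaw 0).aemeasurable hfm]
  have hsl := strong_law_ae (fun i ω => f (O i ω)) (hInt 0)
    (fun i j hij => (iIndepFun_comp_sample hlaw hindep hf.1.aemeasurable).indepFun hij)
    (fun i => identDistrib_comp_sample hlaw hf.1.aemeasurable i 0)
  rw [hmean] at hsl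
  refine eventuallyLikely_norm_sub_lt (tendstoInMeasure_of_tendsto_ae (fun n => ?_) hsl) hε
  exact (Finset.aestronglyMeasurable_fun_sum _ fun i _ => (hInt i).1).const_smul _

/-- This identifies the variance of each one-dimensional projection in the central limit theorem,
and shows that the limiting covariance is positive semidefinite. -/
theorem dotProduct_secondMoment_mulVec {ι : Type*} [Fintype ι]
    {f : α → EuclideanSpace ℝ ι} (hf : MemLp f 2 P) (s t : EuclideanSpace ℝ ι) :
    s.ofLp ⬝ᵥ (Matrix.of fun a b => ∫ o, f o a * f o b ∂P).mulVec t.ofLp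
      = ∫ o, inner ℝ s (f o) * inner ℝ t (f o) ∂P := by
  have hcoord : ∀ a, MemLp (fun o => f o a) 2 P := fun a =>
    hf.continuousLinearMap_comp (EuclideanSpace.proj a : EuclideanSpace ℝ ι →L[ℝ] ℝ)
  have hInt : ∀ a b, Integrable (fun o => f o a * f o b) P := fun a b =>
    (hcoord a).integrable_mul (hcoord b)
  have hexp : ∀ o, inner ℝ s (f o) * inner ℝ t (f o)
      = ∑ a, ∑ b, s a * t b * (f o a * f o b) := by
    intro o
    simp only [PiLp.inner_apply, RCLike.inner_apply, conj_trivial, Finset.sum_mul_sum]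
    exact Finset.sum_congr rfl fun a _ => Finset.sum_congr rfl fun b _ => by ring
  simp_rw [hexp]
  rw [integral_finsetSum _ fun a _ => integrable_finsetSum _ fun b _ => (hInt a b).const_mul _]
  simp only [dotProduct, Matrix.mulVec, Matrix.of_apply, Finset.mul_sum]
  refine Finset.sum_congr rfl fun a _ => ?_
  rw [integral_finsetSum _ fun b _ => (hInt a b).const_mul _]
  refine Finset.sum_congr rfl fun b _ => ?_
  rw [integral_const_mul]
  ring

theorem posSemidef_secondMoment {ι : Type*} [Fintype ι]
    {f : α → EuclideanSpace ℝ ι} (hf : MemLp f 2 P) :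
    (Matrix.of fun a b => ∫ o, f o a * f o b ∂P).PosSemidef := by
  refine Matrix.PosSemidef.of_dotProduct_mulVec_nonneg ?_ fun x => ?_
  · ext a b
    simp [mul_comm]
  · have h := dotProduct_secondMoment_mulVec hf (WithLp.toLp 2 x) (WithLp.toLp 2 x)
    simp only [star_trivial]
    rw [h]
    exact integral_nonneg fun o => mul_self_nonneg _

/-- Multivariate central limit theorem. -/
theorem tendstoInDistribution_sqrt_smul_average [IsProbabilityMeasure Pr]
    [IsProbabilityMeasure P] (hlaw : ∀ i, HasLaw (O i) P Pr)
    (hindep : iIndepFun O Pr) {ι : Type*} [Fintype ι] [DecidableEq ι]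
    {f : α → EuclideanSpace ℝ ι} (hf : MemLp f 2 P) (hf0 : ∫ o, f o ∂P = 0) :
    TendstoInDistribution
      (fun (n : ℕ) ω => Real.sqrt n • ((n : ℝ)⁻¹ • ∑ i ∈ Finset.range n, f (O i ω))) atTop id
      (fun _ => Pr) (multivariateGaussian 0 (Matrix.of fun a b => ∫ o, f o a * f o b ∂P)) := by
  have hfO : ∀ i, AEMeasurable (fun ω => f (O i ω)) Pr := fun i =>
    AEMeasurable.comp_aemeasurable (g := f) (f := O i)
      (by rw [(hlaw i).map_eq]; exact hf.1.aemeasurable) (hlaw i).aemeasurable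
  have hmeas : ∀ n : ℕ, AEMeasurable
      (fun ω => Real.sqrt n • ((n : ℝ)⁻¹ • ∑ i ∈ Finset.range n, f (O i ω))) Pr := by
    intro n
    have := Finset.aemeasurable_fun_sum (Finset.range n) fun i _ => hfO i
    fun_prop
  refine ⟨hmeas, by fun_prop, ?_⟩
  refine ProbabilityMeasure.tendsto_iff_tendsto_charFun.2 fun t => ?_
  have hgL : MemLp (fun o => inner ℝ t (f o)) 2 P :=
    hf.continuousLinearMap_comp (innerSL ℝ t)
  have hg0 : ∫ o, inner ℝ t (f o) ∂P = 0 := by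
    rw [integral_inner (hf.integrable (by norm_num)), hf0, inner_zero_right]
  have hXmem : MemLp (fun ω => inner ℝ t (f (O 0 ω))) 2 Pr :=
    MemLp.comp_of_map (g := fun o => inner ℝ t (f o)) (by rwa [(hlaw 0).map_eq])
      (hlaw 0).aemeasurable
  have hX0 : ∫ ω, inner ℝ t (f (O 0 ω)) ∂Pr = 0 := by
    rw [← hg0, ← (hlaw 0).map_eq, integral_map (hlaw 0).aemeasurable]
    rw [(hlaw 0).map_eq]; exact hgL.1
  have hvar : Var[fun ω => inner ℝ t (f (O 0 ω)); Pr]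
      = t.ofLp ⬝ᵥ (Matrix.of fun a b => ∫ o, f o a * f o b ∂P).mulVec t.ofLp := by
    rw [variance_eq_integral hXmem.1.aemeasurable, hX0, dotProduct_secondMoment_mulVec hf,
      ← (hlaw 0).map_eq, integral_map (hlaw 0).aemeasurable]
    · simp [sq]
    · rw [(hlaw 0).map_eq]; exact hgL.1.mul hgL.1
  -- Cramér–Wold device: the characteristic function of the vector at `t` is that of its projection
  -- on `t` at `1`, so the scalar central limit theorem suffices.
  have hclt := tendstoInDistribution_inv_sqrt_mul_sum_sub
    (X := fun i ω => inner ℝ t (f (O i ω))) (P := Pr)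
    (P' := gaussianReal 0 Var[fun ω => inner ℝ t (f (O 0 ω)); Pr].toNNReal) (Y := id)
    HasLaw.id hXmem (iIndepFun_comp_sample hlaw hindep hgL.1.aemeasurable)
    fun i => identDistrib_comp_sample hlaw hgL.1.aemeasurable i 0
  have h1 := ProbabilityMeasure.tendsto_iff_tendsto_charFun.1 hclt.tendsto 1
  simp only [ProbabilityMeasure.coe_mk, Measure.map_id] at h1 ⊢
  rw [charFun_gaussianReal, Real.coe_toNNReal _ (variance_nonneg _ _), hvar] at h1
  rw [charFun_multivariateGaussian (posSemidef_secondMoment hf)]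
  convert! h1 using 2 with n
  · rw [charFun_apply, charFun_apply, integral_map (hmeas n) (by fun_prop),
      integral_map (hclt.forall_aemeasurable n) (by fun_prop)]
    congr 1 with ω
    congr 3
    rw [hX0, real_inner_comm, inner_smul_right, inner_smul_right, inner_sum]
    have : Real.sqrt n * (n : ℝ)⁻¹ = (Real.sqrt n)⁻¹ := by
      rw [← div_eq_mul_inv, Real.sqrt_div_self']; simp
    simp [← mul_assoc, this]
  · simp

end Sample

/-! ### Double robustness for abstract σ-algebras `m₁ ≤ m₂`, to be generated by `Z₁` and by `(Z₁,
Z₂)`. -/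

section DoubleRobustness

variable {α : Type*} {m₁ m₂ m₀ : MeasurableSpace α} {μ : Measure α} [IsFiniteMeasure μ]
  {R π₀ π u x h : α → ℝ}

theorem condExp_indicator_of_missingAtRandom (h₁₂ : m₁ ≤ m₂) (h₂ : m₂ ≤ m₀)
    (hπ₀ : StronglyMeasurable[m₁] π₀) (hR : μ[R | m₂] =ᵐ[μ] π₀) : μ[R | m₁] =ᵐ[μ] π₀ := by
  have hInt : Integrable π₀ μ := integrable_condExp.congr hR
  calc μ[R | m₁] =ᵐ[μ] μ[μ[R | m₂] | m₁] := (condExp_condExp_of_le h₁₂ h₂).symm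
    _ =ᵐ[μ] μ[π₀ | m₁] := condExp_congr_ae hR
    _ =ᵐ[μ] π₀ := (condExp_of_stronglyMeasurable (h₁₂.trans h₂) hπ₀ hInt).eventuallyEq

/-- Given missingness at random, the observation indicator factors out of conditional
expectations of functions of the full data. -/
theorem condExp_indicator_mul_of_missingAtRandom (h₁₂ : m₁ ≤ m₂) (h₂ : m₂ ≤ m₀)
    (hRm : Measurable R) (hR01 : ∀ a, R a = 0 ∨ R a = 1)
    (hπ₀ : StronglyMeasurable[m₁] π₀) (hR : μ[R | m₂] =ᵐ[μ] π₀)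
    (hx : StronglyMeasurable[m₂] x) (hxi : Integrable x μ) :
    μ[fun a => R a * x a | m₁] =ᵐ[μ] fun a => π₀ a * (μ[x | m₁]) a := by
  have hRb : ∀ a, ‖R a‖ ≤ 1 := fun a => by rcases hR01 a with h | h <;> simp [h]
  have hRi : Integrable R μ := Integrable.of_bound hRm.aestronglyMeasurable 1 (ae_of_all _ hRb)
  have hRx : Integrable (R * x) μ := hxi.bdd_mul hRm.aestronglyMeasurable (ae_of_all _ hRb)
  have h1 : μ[R * x | m₂] =ᵐ[μ] π₀ * x :=
    (condExp_mul_of_stronglyMeasurable_right hx hRx hRi).trans (hR.mul EventuallyEq.rfl)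
  have h2 : Integrable (π₀ * x) μ := integrable_condExp.congr h1
  calc μ[R * x | m₁] =ᵐ[μ] μ[μ[R * x | m₂] | m₁] := (condExp_condExp_of_le h₁₂ h₂).symm
    _ =ᵐ[μ] μ[π₀ * x | m₁] := condExp_congr_ae h1
    _ =ᵐ[μ] π₀ * μ[x | m₁] := condExp_mul_of_stronglyMeasurable_left hπ₀ h2 hxi

/-- Conditional mean of the observed part of an augmented inverse probability weighted
function `u = x / π - (1 - π) / π * h`. -/
theorem condExp_observed_part (h₁₂ : m₁ ≤ m₂) (h₂ : m₂ ≤ m₀)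
    (hRm : Measurable R) (hR01 : ∀ a, R a = 0 ∨ R a = 1)
    (hπ₀ : StronglyMeasurable[m₁] π₀) (hR : μ[R | m₂] =ᵐ[μ] π₀)
    (hπ : StronglyMeasurable[m₁] π) (hπpos : ∀ a, 0 < π a)
    (hx : StronglyMeasurable[m₂] x) (hxi : Integrable x μ) (hui : Integrable u μ)
    (hh : StronglyMeasurable[m₁] h)
    (hobs : ∀ᵐ a ∂μ, R a * (π a * u a) = R a * (x a - (1 - π a) * h a)) :
    ∀ᵐ a ∂μ, π a * (μ[fun a => R a * u a | m₁]) a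
      = π₀ a * ((μ[x | m₁]) a - (1 - π a) * h a) := by
  have hRb : ∀ a, ‖R a‖ ≤ 1 := fun a => by rcases hR01 a with h | h <;> simp [h]
  have hRi : Integrable R μ := Integrable.of_bound hRm.aestronglyMeasurable 1 (ae_of_all _ hRb)
  have hRx : Integrable (fun a => R a * x a) μ :=
    hxi.bdd_mul hRm.aestronglyMeasurable (ae_of_all _ hRb)
  have hRu : Integrable (fun a => R a * u a) μ :=
    hui.bdd_mul hRm.aestronglyMeasurable (ae_of_all _ hRb)
  -- Here `π` is only known to be positive. Both `c` and `c * π` are bounded by one, so they can be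
  -- pulled out of conditional expectations, and `c` is cancelled at the end.
  let c : α → ℝ := fun a => (1 + π a)⁻¹
  have hcpos : ∀ a, 0 < c a := fun a => inv_pos.2 (by linarith [hπpos a])
  have hcm : StronglyMeasurable[m₁] c :=
    ((@measurable_const _ _ _ m₁ 1).add hπ.measurable).inv.stronglyMeasurable
  have hcb : ∀ a, ‖c a‖ ≤ 1 := fun a => by
    rw [Real.norm_of_nonneg (hcpos a).le]
    exact inv_le_one_of_one_le₀ (by linarith [hπpos a])
  have hcπm : StronglyMeasurable[m₁] (c * π) := hcm.mul hπ
  have hcπb : ∀ a, ‖(c * π) a‖ ≤ 1 := fun a => by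
    have := hπpos a
    simp only [Pi.mul_apply, c]
    rw [Real.norm_of_nonneg (by positivity), inv_mul_le_one₀ (by positivity)]
    linarith
  have e1 := condExp_stronglyMeasurable_mul_of_bound (μ := μ) (h₁₂.trans h₂) hcπm hRu 1
    (ae_of_all _ hcπb)
  have e2 := condExp_stronglyMeasurable_mul_of_bound (μ := μ) (h₁₂.trans h₂) hcm hRx 1
    (ae_of_all _ hcb)
  have e3 := condExp_indicator_mul_of_missingAtRandom h₁₂ h₂ hRm hR01 hπ₀ hR hx hxi
  have e4 := condExp_indicator_of_missingAtRandom h₁₂ h₂ hπ₀ hR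
  have i1 : Integrable (c * π * fun a => R a * u a) μ :=
    hRu.bdd_mul (hcπm.mono (h₁₂.trans h₂)).aestronglyMeasurable (ae_of_all _ hcπb)
  have i2 : Integrable (c * fun a => R a * x a) μ :=
    hRx.bdd_mul (hcm.mono (h₁₂.trans h₂)).aestronglyMeasurable (ae_of_all _ hcb)
  -- Integrability of `h` is not available; that of `w * R` follows because `hobs` writes it as a
  -- difference of integrable functions.
  let w : α → ℝ := fun a => c a * (1 - π a) * h a
  have hw : StronglyMeasurable[m₁] w :=
    ((hcm.mul ((@stronglyMeasurable_const _ _ m₁ _ 1).sub hπ)).mul hh)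
  have hwR : (w * R) =ᵐ[μ] (c * fun a => R a * x a) - (c * π * fun a => R a * u a) := by
    filter_upwards [hobs] with a ha
    simp only [Pi.mul_apply, Pi.sub_apply, w]
    linear_combination c a * ha
  have i3 : Integrable (w * R) μ := (i2.sub i1).congr hwR.symm
  have e5 := condExp_mul_of_stronglyMeasurable_left hw i3 hRi
  have e6 := condExp_congr_ae (m := m₁) hwR
  have e7 := condExp_sub i2 i1 m₁
  filter_upwards [e1, e2, e3, e4, e5, e6, e7] with a h1 h2 h3 h4 h5 h6 h7
  rw [h6, h7, Pi.sub_apply, h1, h2] at h5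
  simp only [Pi.mul_apply, h3, h4, w] at h5
  have := (hcpos a).ne'
  apply mul_left_cancel₀ this
  linear_combination -h5

/-- Conditional mean of the unobserved part of an augmented inverse probability weighted
function. -/
theorem condExp_unobserved_part (h₁₂ : m₁ ≤ m₂) (h₂ : m₂ ≤ m₀)
    (hRm : Measurable R) (hR01 : ∀ a, R a = 0 ∨ R a = 1)
    (hπ₀ : StronglyMeasurable[m₁] π₀) (hR : μ[R | m₂] =ᵐ[μ] π₀)
    (hui : Integrable u μ) (hh : StronglyMeasurable[m₁] h)
    (hmis : ∀ᵐ a ∂μ, (1 - R a) * u a = (1 - R a) * h a) :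
    ∀ᵐ a ∂μ, (μ[u | m₁]) a - (μ[fun a => R a * u a | m₁]) a = (1 - π₀ a) * h a := by
  have hRb : ∀ a, ‖R a‖ ≤ 1 := fun a => by rcases hR01 a with h | h <;> simp [h]
  have hRi : Integrable R μ := Integrable.of_bound hRm.aestronglyMeasurable 1 (ae_of_all _ hRb)
  have hRu : Integrable (fun a => R a * u a) μ :=
    hui.bdd_mul hRm.aestronglyMeasurable (ae_of_all _ hRb)
  have h1i : Integrable ((fun _ => 1) - R) μ := (integrable_const 1).sub hRi
  have hu : (h * ((fun _ => 1) - R)) =ᵐ[μ] u - fun a => R a * u a := by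
    filter_upwards [hmis] with a ha
    simp only [Pi.mul_apply, Pi.sub_apply]
    linear_combination -ha
  have i : Integrable (h * ((fun _ => 1) - R)) μ := (hui.sub hRu).congr hu.symm
  have e1 := condExp_mul_of_stronglyMeasurable_left hh i h1i
  have e2 := condExp_congr_ae (m := m₁) hu
  have e3 := condExp_sub hui hRu m₁
  have e4 := condExp_sub (integrable_const (1 : ℝ)) hRi m₁
  have e5 := condExp_indicator_of_missingAtRandom h₁₂ h₂ hπ₀ hR
  rw [condExp_const (h₁₂.trans h₂)] at e4
  filter_upwards [e1, e2, e3, e4, e5] with a h1 h2 h3 h4 h5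
  rw [h2, h3, Pi.mul_apply, h4] at h1
  simp only [Pi.sub_apply, h5] at h1
  rw [h1]
  ring

/-- Limits of augmented inverse probability weighted functions keep the mean of the full-data
function when the propensity model is correct. -/
theorem integral_eq_of_propensity_correct (h₁₂ : m₁ ≤ m₂) (h₂ : m₂ ≤ m₀)
    (hRm : Measurable R) (hR01 : ∀ a, R a = 0 ∨ R a = 1)
    (hπ₀ : StronglyMeasurable[m₁] π₀) (hR : μ[R | m₂] =ᵐ[μ] π₀)
    (hπ : StronglyMeasurable[m₁] π) (hπpos : ∀ a, 0 < π a) (hππ₀ : π =ᵐ[μ] π₀)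
    {us xs hs : ℕ → α → ℝ} (hxs : ∀ n, Measurable[m₂] (xs n)) (hxi : Integrable x μ)
    (hui : Integrable u μ) (hhs : ∀ n, Measurable[m₁] (hs n))
    (hu : ∀ᵐ a ∂μ, Tendsto (fun n => us n a) atTop (𝓝 (u a)))
    (hx : ∀ᵐ a ∂μ, Tendsto (fun n => xs n a) atTop (𝓝 (x a)))
    (hobs : ∀ n a, R a * (π a * us n a) = R a * (xs n a - (1 - π a) * hs n a))
    (hmis : ∀ n a, (1 - R a) * us n a = (1 - R a) * hs n a) :
    ∫ a, u a ∂μ = ∫ a, x a ∂μ := by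
  -- Almost sure limits are only measurable up to null sets; the limsup provides versions measurable
  -- for `m₂` and `m₁` themselves.
  let x' : α → ℝ := fun a => limsup (fun n => xs n a) atTop
  let h' : α → ℝ := fun a => limsup (fun n => hs n a) atTop
  have hx'm : StronglyMeasurable[m₂] x' := (Measurable.limsup hxs).stronglyMeasurable
  have hh'm : StronglyMeasurable[m₁] h' := (Measurable.limsup hhs).stronglyMeasurable
  have hx' : x =ᵐ[μ] x' := by
    filter_upwards [hx] with a ha using ha.limsup_eq.symm
  have hx'i : Integrable x' μ := hxi.congr hx'
  have hobs' : ∀ᵐ a ∂μ, R a * (π a * u a) = R a * (x' a - (1 - π a) * h' a) := by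
    filter_upwards [hu, hx, hx'] with a hua hxa hxa'
    rcases hR01 a with h | h
    · simp [h]
    simp only [h, one_mul] at hobs ⊢
    rw [← hxa']
    -- Where `R = 1`, the sequence `hs n a` converges unless its coefficient `1 - π a` vanishes, and
    -- then the value of the limsup is immaterial.
    by_cases h1 : 1 - π a = 0
    · have := tendsto_nhds_unique (hua.const_mul (π a)) (hxa.congr fun n => ?_)
      · simpa [h1] using this
      · have := hobs n a; simp only [h, h1] at this; linarith
    · have hlim : Tendsto (fun n => hs n a) atTop (𝓝 ((x a - π a * u a) / (1 - π a))) := by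
        refine ((hxa.sub (hua.const_mul (π a))).div_const (1 - π a)).congr fun n => ?_
        have := hobs n a; simp only [h] at this
        field_simp
        linarith
      have : h' a = (x a - π a * u a) / (1 - π a) := hlim.limsup_eq
      rw [this]
      field_simp
      ring
  have hmis' : ∀ᵐ a ∂μ, (1 - R a) * u a = (1 - R a) * h' a := by
    filter_upwards [hu] with a hua
    rcases hR01 a with h | h
    · have : Tendsto (fun n => hs n a) atTop (𝓝 (u a)) := hua.congr fun n => by
        have := hmis n a; simpa [h] using this
      rw [show h' a = u a from this.limsup_eq]
    · simp [h]
  have e1 := condExp_observed_part h₁₂ h₂ hRm hR01 hπ₀ hR hπ hπpos hx'm hx'i hui hh'm hobs'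
  have e2 := condExp_unobserved_part h₁₂ h₂ hRm hR01 hπ₀ hR hui hh'm hmis'
  rw [← integral_condExp (h₁₂.trans h₂), ← integral_condExp (h₁₂.trans h₂) (f := x)]
  refine integral_congr_ae ?_
  filter_upwards [e1, e2, hππ₀, condExp_congr_ae (m := m₁) hx'] with a h1 h2 h3 h4
  rw [← h3] at h1 h2
  have := mul_left_cancel₀ (hπpos a).ne' h1
  rw [h4]
  linarith

/-- Limits of augmented inverse probability weighted functions keep the mean of the full-data
function when the outcome model is correct. -/
theorem integral_eq_of_outcome_correct (h₁₂ : m₁ ≤ m₂) (h₂ : m₂ ≤ m₀)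
    (hRm : Measurable R) (hR01 : ∀ a, R a = 0 ∨ R a = 1)
    (hπ₀ : StronglyMeasurable[m₁] π₀) (hR : μ[R | m₂] =ᵐ[μ] π₀)
    (hπ₀pos : ∀ᵐ a ∂μ, 0 < π₀ a)
    (hπ : StronglyMeasurable[m₁] π) (hπpos : ∀ a, 0 < π a)
    {us xs hs : ℕ → α → ℝ} (hxs : ∀ n, Measurable[m₂] (xs n))
    (hxsi : ∀ n, Integrable (xs n) μ) (hxi : Integrable x μ)
    (husm : ∀ n, AEStronglyMeasurable (us n) μ) {G : α → ℝ} (hG : Integrable G μ)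
    (husG : ∀ n, ∀ᵐ a ∂μ, ‖us n a‖ ≤ G a) (hhs : ∀ n, Measurable[m₁] (hs n))
    (hu : ∀ᵐ a ∂μ, Tendsto (fun n => us n a) atTop (𝓝 (u a)))
    (hx : ∀ᵐ a ∂μ, Tendsto (fun n => xs n a) atTop (𝓝 (x a)))
    (hobs : ∀ n a, R a * (π a * us n a) = R a * (xs n a - (1 - π a) * hs n a))
    (hmis : ∀ n a, (1 - R a) * us n a = (1 - R a) * hs n a)
    (hout : ∀ n, μ[xs n | m₁] =ᵐ[μ] hs n) :
    ∫ a, u a ∂μ = ∫ a, x a ∂μ := by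
  have hRb : ∀ a, ‖R a‖ ≤ 1 := fun a => by rcases hR01 a with h | h <;> simp [h]
  have husi : ∀ n, Integrable (us n) μ := fun n => hG.mono' (husm n) (husG n)
  have hum : AEStronglyMeasurable u μ := aestronglyMeasurable_of_tendsto_ae _ husm hu
  have huG : ∀ᵐ a ∂μ, ‖u a‖ ≤ G a := by
    filter_upwards [hu, ae_all_iff.2 husG] with a ha hb
    exact le_of_tendsto' ha.norm hb
  have hui : Integrable u μ := hG.mono' hum huG
  -- With `E[xs n ∣ m₁] = hs n`, the right-hand side for the observed part collapses to `π₀ π hs n`,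
  -- and `π` cancels.
  have hn : ∀ n, ∀ᵐ a ∂μ, (μ[fun a => R a * us n a | m₁]) a = π₀ a * hs n a := by
    intro n
    filter_upwards [condExp_observed_part h₁₂ h₂ hRm hR01 hπ₀ hR hπ hπpos
      (hxs n).stronglyMeasurable (hxsi n) (husi n) (hhs n).stronglyMeasurable
      (ae_of_all _ (hobs n)), hout n] with a h1 h2
    rw [h2] at h1
    apply mul_left_cancel₀ (hπpos a).ne'
    rw [h1]
    ring
  -- The `xs n` have no common envelope, so their conditional means cannot be passed to the limit
  -- directly. The functions `R * us n` are dominated; their conditional means converge in `L¹`,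
  -- almost surely along a subsequence, and division by `π₀ > 0` gives the limit `g` of the `hs n`.
  have hL1 := tendsto_condExpL1_of_dominated_convergence (μ := μ) (h₁₂.trans h₂)
    (fs := fun n a => R a * us n a) (f := fun a => R a * u a) G
    (fun n => hRm.aestronglyMeasurable.mul (husm n)) hG
    (fun n => by
      filter_upwards [husG n] with a ha
      rw [norm_mul]
      exact (mul_le_of_le_one_left (norm_nonneg _) (hRb a)).trans ha)
    (by filter_upwards [hu] with a ha using ha.const_mul _)
  obtain ⟨ns, hmono, hns⟩ := (tendstoInMeasure_of_tendsto_Lp hL1).exists_seq_tendsto_ae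
  let g : α → ℝ := fun a => (μ[fun a => R a * u a | m₁]) a / π₀ a
  have hgm : StronglyMeasurable[m₁] g :=
    (stronglyMeasurable_condExp.measurable.div hπ₀.measurable).stronglyMeasurable
  have hlim : ∀ᵐ a ∂μ, Tendsto (fun k => hs (ns k) a) atTop (𝓝 (g a)) := by
    filter_upwards [hns, condExp_ae_eq_condExpL1 (μ := μ) (h₁₂.trans h₂) (fun a => R a * u a),
      ae_all_iff.2 fun n =>
        condExp_ae_eq_condExpL1 (μ := μ) (h₁₂.trans h₂) (fun a => R a * us n a),
      ae_all_iff.2 hn, hπ₀pos] with a h1 h2 h3 h4 h5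
    rw [← h2] at h1
    refine (h1.div_const (π₀ a)).congr fun k => ?_
    rw [← h3, h4]
    field_simp
  let x' : α → ℝ := fun a => limsup (fun n => xs n a) atTop
  have hx'm : StronglyMeasurable[m₂] x' := (Measurable.limsup hxs).stronglyMeasurable
  have hx' : x =ᵐ[μ] x' := by
    filter_upwards [hx] with a ha using ha.limsup_eq.symm
  have hsub : ∀ᵐ a ∂μ, Tendsto ns atTop atTop := ae_of_all _ fun _ => hmono.tendsto_atTop
  have hobs' : ∀ᵐ a ∂μ, R a * (π a * u a) = R a * (x' a - (1 - π a) * g a) := by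
    filter_upwards [hu, hx, hx', hlim, hsub] with a h1 h2 h3 h4 h5
    rw [← h3]
    refine tendsto_nhds_unique (((h1.comp h5).const_mul (π a)).const_mul (R a)) ?_
    exact (((h2.comp h5).sub (h4.const_mul (1 - π a))).const_mul (R a)).congr fun k =>
      (hobs (ns k) a).symm
  have hmis' : ∀ᵐ a ∂μ, (1 - R a) * u a = (1 - R a) * g a := by
    filter_upwards [hu, hlim, hsub] with a h1 h4 h5
    refine tendsto_nhds_unique ((h1.comp h5).const_mul (1 - R a)) ?_
    exact (h4.const_mul (1 - R a)).congr fun k => (hmis (ns k) a).symm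
  have e1 := condExp_observed_part h₁₂ h₂ hRm hR01 hπ₀ hR hπ hπpos hx'm (hxi.congr hx') hui hgm
    hobs'
  have e2 := condExp_unobserved_part h₁₂ h₂ hRm hR01 hπ₀ hR hui hgm hmis'
  rw [← integral_condExp (h₁₂.trans h₂), ← integral_condExp (h₁₂.trans h₂) (f := x)]
  refine integral_congr_ae ?_
  filter_upwards [e1, e2, condExp_congr_ae (m := m₁) hx', hπ₀pos] with a h1 h2 h3 h4
  have hg : (μ[fun a => R a * u a | m₁]) a = π₀ a * g a := by simp only [g]; field_simp
  rw [hg] at h1 h2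
  rw [h3]
  -- The limit `g` is again the conditional mean of the limiting full-data function, so the outcome
  -- model remains correct in the limit.
  have : (μ[x' | m₁]) a = g a := by
    apply mul_left_cancel₀ h4.ne'
    linear_combination -h1
  rw [this]
  linarith

end DoubleRobustness

/-! ### Uniform weak law of large numbers on a compact set. -/

section UniformLaw

theorem norm_average_sub_average_le {E : Type*} [SeminormedAddCommGroup E] [NormedSpace ℝ E] {n : ℕ}
    {f g : ℕ → E} {r : ℕ → ℝ} (h : ∀ i, ‖f i - g i‖ ≤ r i) :
    ‖(n : ℝ)⁻¹ • ∑ i ∈ Finset.range n, f i - (n : ℝ)⁻¹ • ∑ i ∈ Finset.range n, g i‖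
      ≤ (n : ℝ)⁻¹ • ∑ i ∈ Finset.range n, r i := by
  rw [← smul_sub, ← Finset.sum_sub_distrib, norm_smul, Real.norm_of_nonneg (by positivity),
    smul_eq_mul]
  gcongr
  exact norm_sum_le_of_le _ fun i _ => h i

variable {Ω α : Type*} [MeasurableSpace Ω] [MeasurableSpace α] [StandardBorelSpace α]
  {Pr : Measure Ω} {P : Measure α} {O : ℕ → Ω → α}

/-- On balls shrinking to `y` the oscillation tends to zero almost surely by continuity at `y`, and
`2 H` dominates it, so its supremum becomes small in mean. -/
theorem exists_integrable_oscillation_bound [IsFiniteMeasure P] {Y E : Type*} [MetricSpace Y]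
    [MeasurableSpace Y] [BorelSpace Y] [StandardBorelSpace Y] [NormedAddCommGroup E]
    [MeasurableSpace E] [BorelSpace E] [SecondCountableTopology E]
    {F : α → Y → E} (hF : Measurable fun x : α × Y => F x.1 x.2) {B : Set Y}
    (hB : MeasurableSet B) {H : α → ℝ} (hH : Integrable H P)
    (hFH : ∀ᵐ o ∂P, ∀ y ∈ B, ‖F o y‖ ≤ H o) {y : Y} (hy : y ∈ B)
    (hcont : ∀ᵐ o ∂P, ContinuousWithinAt (F o) B y) {ε : ℝ} (hε : 0 < ε) :
    ∃ δ > 0, ∃ ρ : α → ℝ, Integrable ρ P ∧ ∫ o, ρ o ∂P < ε ∧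
      ∀ᵐ o ∂P, ∀ y' ∈ B, dist y' y < δ → ‖F o y' - F o y‖ ≤ ρ o := by
  obtain ⟨k, ρ, hρ, hρε, hle⟩ := exists_integrable_majorant_integral_lt P
    (g := fun o y' => ‖F o y' - F o y‖)
    (S := fun k => B ∩ Metric.ball y (1 / ((k : ℝ) + 1)))
    (by
      have : Measurable fun x : α × Y => F x.1 y :=
        hF.comp (measurable_fst.prodMk measurable_const)
      exact (hF.sub this).norm)
    (fun k => hB.inter measurableSet_ball)
    (fun a b hab => Set.inter_subset_inter_right _
      (Metric.ball_subset_ball (Nat.one_div_le_one_div hab)))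
    (hH.add hH)
    (by
      filter_upwards [hFH] with o ho y' hy'
      exact (norm_sub_le _ _).trans (add_le_add (ho y' hy'.1) (ho y hy)))
    (by
      filter_upwards [hcont] with o ho η hη
      obtain ⟨δ, hδ, hδ'⟩ := Metric.continuousWithinAt_iff.1 ho η hη
      obtain ⟨k, hk⟩ := exists_nat_one_div_lt hδ
      refine ⟨k, fun y' hy' => ?_⟩
      rw [← dist_eq_norm]
      exact (hδ' hy'.1 (lt_trans hy'.2 hk)).le)
    hε
  refine ⟨1 / ((k : ℝ) + 1), by positivity, ρ, hρ, hρε, ?_⟩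
  filter_upwards [hle] with o ho y' hy' hd using ho y' ⟨hy', hd⟩

/-- Uniform weak law of large numbers over a compact parameter set. -/
theorem eventuallyLikely_uniform_average [IsFiniteMeasure Pr] [IsFiniteMeasure P]
    (hlaw : ∀ i, HasLaw (O i) P Pr) (hindep : iIndepFun O Pr) {Y E : Type*} [MetricSpace Y]
    [MeasurableSpace Y] [BorelSpace Y] [StandardBorelSpace Y] [NormedAddCommGroup E]
    [NormedSpace ℝ E] [CompleteSpace E] [MeasurableSpace E] [BorelSpace E]
    [SecondCountableTopology E]
    {F : α → Y → E} (hF : Measurable fun x : α × Y => F x.1 x.2) {B : Set Y}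
    (hB : IsCompact B) {H : α → ℝ} (hH : Integrable H P)
    (hFH : ∀ᵐ o ∂P, ∀ y ∈ B, ‖F o y‖ ≤ H o)
    (hcont : ∀ y ∈ B, ∀ᵐ o ∂P, ContinuousWithinAt (F o) B y) {ε : ℝ} (hε : 0 < ε) :
    EventuallyLikely Pr fun n ω => ∀ y ∈ B,
      ‖(n : ℝ)⁻¹ • ∑ i ∈ Finset.range n, F (O i ω) y - ∫ o, F o y ∂P‖ < ε := by
  have hFy : ∀ y ∈ B, Integrable (fun o => F o y) P := by
    intro y hy
    have hm : Measurable fun o => F o y := hF.comp (measurable_id.prodMk measurable_const)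
    refine hH.mono' hm.aestronglyMeasurable ?_
    filter_upwards [hFH] with o ho using ho y hy
  have hex : ∀ y : Y, ∃ δ > 0, ∃ ρ : α → ℝ, y ∈ B → (Integrable ρ P ∧ ∫ o, ρ o ∂P < ε / 4 ∧
      ∀ᵐ o ∂P, ∀ y' ∈ B, dist y' y < δ → ‖F o y' - F o y‖ ≤ ρ o) := by
    intro y
    by_cases hy : y ∈ B
    · obtain ⟨δ, hδ, ρ, h⟩ := exists_integrable_oscillation_bound hF hB.measurableSet hH hFH hy
        (hcont y hy) (show 0 < ε / 4 by linarith)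
      exact ⟨δ, hδ, ρ, fun _ => h⟩
    · exact ⟨1, one_pos, 0, fun h => absurd h hy⟩
  choose δ hδ ρ hρ using hex
  -- Only the finitely many centres need a law of large numbers. The error budget of `ε / 4` is
  -- spent once at the centre, once on the oscillation of the mean, and twice on the averaged
  -- oscillation (its mean and its deviation from it).
  obtain ⟨t, htB, ht⟩ := hB.elim_nhds_subcover (fun y => Metric.ball y (δ y))
    fun y _ => Metric.ball_mem_nhds y (hδ y)
  have h1 := EventuallyLikely.finset_forall (Pr := Pr) t fun y hy =>
    eventuallyLikely_average hlaw hindep (hFy y (htB y hy)) (show 0 < ε / 4 by linarith)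
  have h2 := EventuallyLikely.finset_forall (Pr := Pr) t fun y hy =>
    eventuallyLikely_average hlaw hindep (hρ y (htB y hy)).1 (show 0 < ε / 4 by linarith)
  have h3 : ∀ᵐ ω ∂Pr, ∀ y ∈ t, ∀ i, ∀ y' ∈ B, dist y' y < δ y →
      ‖F (O i ω) y' - F (O i ω) y‖ ≤ ρ y (O i ω) :=
    (ae_ball_iff t.countable_toSet).2 fun y hy => ae_forall_sample hlaw (hρ y (htB y hy)).2.2
  refine (h1.and h2).mono (Eventually.of_forall fun n => ?_)
  filter_upwards [h3] with ω hω h y' hy'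
  obtain ⟨y, hyt, hyy'⟩ := Set.mem_iUnion₂.1 (ht hy')
  obtain ⟨hρi, hρε, hρle⟩ := hρ y (htB y hyt)
  have a1 := h.1 y hyt
  have a2 := (abs_lt.1 (h.2 y hyt)).2
  have a3 := norm_average_sub_average_le (n := n) fun i => hω y hyt i y' hy' hyy'
  have a4 : ‖(∫ o, F o y ∂P) - ∫ o, F o y' ∂P‖ ≤ ∫ o, ρ y o ∂P := by
    rw [← integral_sub (hFy y (htB y hyt)) (hFy y' hy')]
    refine norm_integral_le_of_norm_le hρi ?_
    filter_upwards [hρle] with o ho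
    rw [norm_sub_rev]
    exact ho y' hy' hyy'
  have a5 := norm_add₃_le (a := (n : ℝ)⁻¹ • ∑ i ∈ Finset.range n, F (O i ω) y'
      - (n : ℝ)⁻¹ • ∑ i ∈ Finset.range n, F (O i ω) y)
    (b := (n : ℝ)⁻¹ • ∑ i ∈ Finset.range n, F (O i ω) y - ∫ o, F o y ∂P)
    (c := (∫ o, F o y ∂P) - ∫ o, F o y' ∂P)
  rw [sub_add_sub_cancel, sub_add_sub_cancel] at a5
  linarith

end UniformLaw

/-! ### Measurability and double robustness of the estimating function. -/

section EstimatingFunction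

variable {d p q : ℕ} (M : Ingredients d p q) (P : Measure (Obs d)) (β₀ : Vec 2)

@[fun_prop]
theorem measurable_z1 : Measurable (z1 : Obs d → Fin d → ℝ) := measurable_fst

@[fun_prop]
theorem measurable_z2 : Measurable (z2 : Obs d → ℝ) := measurable_fst.comp measurable_snd

@[fun_prop]
theorem measurable_rInd : Measurable (rInd : Obs d → ℝ) :=
  (measurable_from_top (f := fun b : Bool => if b then (1 : ℝ) else 0)).comp
    (measurable_snd.comp measurable_snd)

theorem rInd_eq_zero_or_one (o : Obs d) : rInd o = 0 ∨ rInd o = 1 := by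
  unfold rInd
  split_ifs <;> simp

theorem sigmaZ1_le_sigmaZ : sigmaZ1 d ≤ sigmaZ d := by
  have : (z1 : Obs d → Fin d → ℝ) = Prod.fst ∘ fun o : Obs d => (z1 o, z2 o) := rfl
  rw [sigmaZ1, this, ← MeasurableSpace.comap_comp]
  exact MeasurableSpace.comap_mono measurable_fst.comap_le

theorem sigmaZ_le : sigmaZ d ≤ (inferInstance : MeasurableSpace (Obs d)) :=
  (measurable_z1.prodMk measurable_z2).comap_le

theorem measurable_vec_of_coord {α : Type*} [MeasurableSpace α] {ι : Type*} [Fintype ι]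
    {f : α → EuclideanSpace ℝ ι} (h : ∀ k, Measurable fun a => f a k) : Measurable f :=
  (WithLp.measurable_toLp 2 (ι → ℝ)).comp (measurable_pi_iff.2 h)

theorem measurable_mPsi :
    Measurable fun x : Obs d × Vec 2 => mPsi M P β₀ x.1 x.2 := by
  have h0 : Measurable fun x : Obs d × Vec 2 => (z2 x.1 - x.2 0) / x.2 1 := by
    fun_prop
  refine measurable_vec_of_coord fun k => ?_
  fin_cases k
  · exact (M.measurable_psiMu.comp h0).sub_const _
  · exact ((M.measurable_psiSigma.comp h0).pow_const 2).sub_const _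

theorem measurable_phi :
    Measurable fun x : Obs d × Vec 2 × Vec p × Vec q => phi M P β₀ x.1 x.2.1 x.2.2.1 x.2.2.2 := by
  have h1 : Measurable fun x : Obs d × Vec 2 × Vec p × Vec q => M.prop (z1 x.1) x.2.2.1 :=
    M.measurable_prop.comp (f := fun x : Obs d × Vec 2 × Vec p × Vec q => (z1 x.1, x.2.2.1))
      (by fun_prop)
  have h2 : Measurable fun x : Obs d × Vec 2 × Vec p × Vec q => M.h (z1 x.1) x.2.1 x.2.2.2 :=
    M.measurable_h.comp
      (f := fun x : Obs d × Vec 2 × Vec p × Vec q => (z1 x.1, x.2.1, x.2.2.2)) (by fun_prop)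
  have h3 : Measurable fun x : Obs d × Vec 2 × Vec p × Vec q => mPsi M P β₀ x.1 x.2.1 :=
    (measurable_mPsi M P β₀).comp
      (f := fun x : Obs d × Vec 2 × Vec p × Vec q => (x.1, x.2.1)) (by fun_prop)
  unfold phi
  fun_prop

theorem measurable_mPsi_coord_sigmaZ (β : Vec 2) (k : Fin 2) :
    Measurable[sigmaZ d] fun o => mPsi M P β₀ o β k := by
  have hz : Measurable[sigmaZ d] (z2 : Obs d → ℝ) :=
    measurable_snd.comp (comap_measurable (fun o : Obs d => (z1 o, z2 o)))
  have h0 : Measurable[sigmaZ d] fun o : Obs d => (z2 o - β 0) / β 1 :=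
    (hz.sub_const _).div_const _
  fin_cases k
  · exact (M.measurable_psiMu.comp h0).sub_const _
  · exact ((M.measurable_psiSigma.comp h0).pow_const 2).sub_const _

theorem measurable_h_coord_sigmaZ1 (β : Vec 2) (ξ : Vec q) (k : Fin 2) :
    Measurable[sigmaZ1 d] fun o : Obs d => M.h (z1 o) β ξ k := by
  have h0 : Measurable fun z : Fin d → ℝ => M.h z β ξ k :=
    (EuclideanSpace.proj k : Vec 2 →L[ℝ] ℝ).measurable.comp
      (M.measurable_h.comp (f := fun z : Fin d → ℝ => (z, β, ξ)) (by fun_prop))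
  exact h0.comp (comap_measurable z1)

theorem measurable_prop_sigmaZ1 (γ : Vec p) :
    Measurable[sigmaZ1 d] fun o : Obs d => M.prop (z1 o) γ := by
  have h0 : Measurable fun z : Fin d → ℝ => M.prop z γ :=
    M.measurable_prop.comp (f := fun z : Fin d → ℝ => (z, γ)) (by fun_prop)
  exact h0.comp (comap_measurable z1)

/-- Together with `phi_unobserved`, this is all the algebra that double robustness needs from the
formula of `phi`. Both identities are linear in `phi`, `mPsi` and `h` jointly, so they survive
linear combinations over `β`. -/
theorem phi_observed (o : Obs d) (β : Vec 2) (γ : Vec p) (ξ : Vec q) (k : Fin 2) :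
    rInd o * (M.prop (z1 o) γ * phi M P β₀ o β γ ξ k)
      = rInd o * (mPsi M P β₀ o β k - (1 - M.prop (z1 o) γ) * M.h (z1 o) β ξ k) := by
  have := (M.prop_pos (z1 o) γ).ne'
  rcases rInd_eq_zero_or_one o with h | h
  · simp [h]
  · simp only [phi, h, PiLp.sub_apply, PiLp.smul_apply, smul_eq_mul]
    field_simp

theorem phi_unobserved (o : Obs d) (β : Vec 2) (γ : Vec p) (ξ : Vec q) (k : Fin 2) :
    (1 - rInd o) * phi M P β₀ o β γ ξ k = (1 - rInd o) * M.h (z1 o) β ξ k := by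
  have := (M.prop_pos (z1 o) γ).ne'
  rcases rInd_eq_zero_or_one o with h | h
  · simp only [phi, h, PiLp.sub_apply, PiLp.smul_apply, smul_eq_mul]
    field_simp
    ring
  · simp [h]

variable {M P β₀}

/-- Double robustness: limits of linear combinations of the estimating function at two parameter
values have the mean of the corresponding limits for the full-data estimating function. -/
theorem integral_limit_phi_eq_integral_limit_mPsi [IsProbabilityMeasure P]
    (hMAR : MissingAtRandom P) {B : Set (Vec 2)} {γs : Vec p} {ξs : Vec q}
    (hcorrect : PropensityCorrect M P γs ∨ OutcomeCorrect M P β₀ B ξs) (k : Fin 2)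
    {b : ℕ → Vec 2} {β : Vec 2} (hb : ∀ n, b n ∈ B) (hβ : β ∈ B) (s t : ℕ → ℝ)
    {u x : Obs d → ℝ}
    (hu : ∀ᵐ o ∂P, Tendsto
      (fun n => s n * phi M P β₀ o (b n) γs ξs k - t n * phi M P β₀ o β γs ξs k) atTop (𝓝 (u o)))
    (hx : ∀ᵐ o ∂P, Tendsto
      (fun n => s n * mPsi M P β₀ o (b n) k - t n * mPsi M P β₀ o β k) atTop (𝓝 (x o)))
    {G : Obs d → ℝ} (hG : Integrable G P)
    (huG : ∀ n, ∀ᵐ o ∂P,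
      ‖s n * phi M P β₀ o (b n) γs ξs k - t n * phi M P β₀ o β γs ξs k‖ ≤ G o)
    (hxi : Integrable x P) :
    ∫ o, u o ∂P = ∫ o, x o ∂P := by
  obtain ⟨π₀, hπ₀, hπ₀pos, hR⟩ := hMAR
  have hπ₀m : StronglyMeasurable[sigmaZ1 d] fun o : Obs d => π₀ (z1 o) :=
    (hπ₀.comp (comap_measurable z1)).stronglyMeasurable
  have hphim : ∀ β, Measurable fun o => phi M P β₀ o β γs ξs k := fun β =>
    (EuclideanSpace.proj k : Vec 2 →L[ℝ] ℝ).measurable.comp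
      ((measurable_phi M P β₀).comp (f := fun o : Obs d => (o, β, γs, ξs)) (by fun_prop))
  have husm : ∀ n, AEStronglyMeasurable
      (fun o => s n * phi M P β₀ o (b n) γs ξs k - t n * phi M P β₀ o β γs ξs k) P := fun n =>
    (((hphim _).const_mul _).sub ((hphim _).const_mul _)).aestronglyMeasurable
  have hxs : ∀ n, Measurable[sigmaZ d]
      fun o => s n * mPsi M P β₀ o (b n) k - t n * mPsi M P β₀ o β k := fun n =>
    ((measurable_mPsi_coord_sigmaZ M P β₀ _ k).const_mul _).sub
      ((measurable_mPsi_coord_sigmaZ M P β₀ _ k).const_mul _)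
  have hhs : ∀ n, Measurable[sigmaZ1 d]
      fun o : Obs d => s n * M.h (z1 o) (b n) ξs k - t n * M.h (z1 o) β ξs k := fun n =>
    ((measurable_h_coord_sigmaZ1 M _ _ k).const_mul _).sub
      ((measurable_h_coord_sigmaZ1 M _ _ k).const_mul _)
  have hobs : ∀ (n : ℕ) (o : Obs d), rInd o * (M.prop (z1 o) γs *
        (s n * phi M P β₀ o (b n) γs ξs k - t n * phi M P β₀ o β γs ξs k))
      = rInd o * ((s n * mPsi M P β₀ o (b n) k - t n * mPsi M P β₀ o β k)
        - (1 - M.prop (z1 o) γs) * (s n * M.h (z1 o) (b n) ξs k - t n * M.h (z1 o) β ξs k)) := by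
    intro n o
    linear_combination s n * phi_observed M P β₀ o (b n) γs ξs k
      - t n * phi_observed M P β₀ o β γs ξs k
  have hmis : ∀ (n : ℕ) (o : Obs d), (1 - rInd o) *
        (s n * phi M P β₀ o (b n) γs ξs k - t n * phi M P β₀ o β γs ξs k)
      = (1 - rInd o) * (s n * M.h (z1 o) (b n) ξs k - t n * M.h (z1 o) β ξs k) := by
    intro n o
    linear_combination s n * phi_unobserved M P β₀ o (b n) γs ξs k
      - t n * phi_unobserved M P β₀ o β γs ξs k
  have hπm := (measurable_prop_sigmaZ1 M γs).stronglyMeasurable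
  rcases hcorrect with hprop | hout
  · have hππ₀ : (fun o : Obs d => M.prop (z1 o) γs) =ᵐ[P] fun o => π₀ (z1 o) :=
      hprop.symm.trans (condExp_indicator_of_missingAtRandom sigmaZ1_le_sigmaZ sigmaZ_le hπ₀m hR)
    have hui : Integrable u P := by
      refine hG.mono' (aestronglyMeasurable_of_tendsto_ae _ husm hu) ?_
      filter_upwards [hu, ae_all_iff.2 huG] with o h1 h2
      exact le_of_tendsto' h1.norm h2
    exact integral_eq_of_propensity_correct sigmaZ1_le_sigmaZ sigmaZ_le measurable_rInd
      rInd_eq_zero_or_one hπ₀m hR hπm (fun o => M.prop_pos _ _) hππ₀ hxs hxi hui hhs hu hx hobs hmis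
  · have hInt : ∀ β ∈ B, Integrable (fun o => mPsi M P β₀ o β k) P := fun β hβ =>
      (EuclideanSpace.proj k : Vec 2 →L[ℝ] ℝ).integrable_comp (hout β hβ).1
    have hce : ∀ β ∈ B, P[fun o => mPsi M P β₀ o β k | sigmaZ1 d]
        =ᵐ[P] fun o => M.h (z1 o) β ξs k := by
      intro β hβ
      have h1 := (EuclideanSpace.proj k : Vec 2 →L[ℝ] ℝ).comp_condExp_comm (m := sigmaZ1 d)
        (hout β hβ).1
      filter_upwards [h1, (hout β hβ).2] with o h2 h3
      refine h2.symm.trans ?_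
      simp [h3]
    refine integral_eq_of_outcome_correct sigmaZ1_le_sigmaZ sigmaZ_le measurable_rInd
      rInd_eq_zero_or_one hπ₀m hR hπ₀pos hπm (fun o => M.prop_pos _ _) hxs
      (fun n => ((hInt _ (hb n)).const_mul _).sub ((hInt _ hβ).const_mul _)) hxi husm hG huG hhs
      hu hx hobs hmis fun n => ?_
    filter_upwards [condExp_sub ((hInt _ (hb n)).const_mul (s n)) ((hInt _ hβ).const_mul (t n))
        (sigmaZ1 d), condExp_smul (μ := P) (s n) (fun o => mPsi M P β₀ o (b n) k) (sigmaZ1 d),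
      condExp_smul (μ := P) (t n) (fun o => mPsi M P β₀ o β k) (sigmaZ1 d),
      hce _ (hb n), hce _ hβ] with o h1 h2 h3 h4 h5
    refine h1.trans ?_
    rw [Pi.sub_apply]
    refine (congrArg₂ (· - ·) h2 h3).trans ?_
    simp [h4, h5]

/-- The estimating function at the limits of the nuisance parameters has the mean of the
full-data estimating function. -/
theorem integral_phi_eq_integral_mPsi [IsProbabilityMeasure P]
    (hMAR : MissingAtRandom P) {B : Set (Vec 2)} {γs : Vec p} {ξs : Vec q}
    (hcorrect : PropensityCorrect M P γs ∨ OutcomeCorrect M P β₀ B ξs) {β : Vec 2} (hβ : β ∈ B)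
    (hphi : Integrable (fun o => phi M P β₀ o β γs ξs) P)
    (hm : Integrable (fun o => mPsi M P β₀ o β) P) :
    ∫ o, phi M P β₀ o β γs ξs ∂P = ∫ o, mPsi M P β₀ o β ∂P := by
  ext k
  have h1 := (EuclideanSpace.proj k : Vec 2 →L[ℝ] ℝ).integral_comp_comm hphi
  have h2 := (EuclideanSpace.proj k : Vec 2 →L[ℝ] ℝ).integral_comp_comm hm
  simp only [EuclideanSpace.coe_proj] at h1 h2
  rw [← h1, ← h2]
  have i1 := (EuclideanSpace.proj k : Vec 2 →L[ℝ] ℝ).integrable_comp hphi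
  have i2 := (EuclideanSpace.proj k : Vec 2 →L[ℝ] ℝ).integrable_comp hm
  -- Constant sequence with weights `1` and `0`: the limit is the function itself.
  refine integral_limit_phi_eq_integral_limit_mPsi hMAR hcorrect k (b := fun _ => β)
    (fun _ => hβ) hβ (fun _ => 1) (fun _ => 0) (ae_of_all _ fun o => ?_)
    (ae_of_all _ fun o => ?_) i1.norm (fun n => ae_of_all _ fun o => ?_) i2
  · simp
  · simp
  · simp

end EstimatingFunction

/-! ### Consistency of the minimizer. -/

section Consistency

variable {d p q : ℕ} {M : Ingredients d p q} {P : Measure (Obs d)} {β₀ : Vec 2}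
  {γs : Vec p} {ξs : Vec q} {B : Set (Vec 2)}

theorem Qhat_eq_norm_average_sq (n : ℕ) (o : ℕ → Obs d) (β : Vec 2) (γ : Vec p) (ξ : Vec q) :
    Qhat M P β₀ n o β γ ξ
      = ‖(n : ℝ)⁻¹ • ∑ i ∈ Finset.range n, phi M P β₀ (o i) β γ ξ‖ ^ 2 := by
  rw [Qhat, norm_smul, mul_pow]
  simp

theorem norm_average_le_of_Qhat_le {n : ℕ} {o : ℕ → Obs d} {β β' : Vec 2} {γ : Vec p} {ξ : Vec q}
    (h : Qhat M P β₀ n o β γ ξ ≤ Qhat M P β₀ n o β' γ ξ) :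
    ‖(n : ℝ)⁻¹ • ∑ i ∈ Finset.range n, phi M P β₀ (o i) β γ ξ‖
      ≤ ‖(n : ℝ)⁻¹ • ∑ i ∈ Finset.range n, phi M P β₀ (o i) β' γ ξ‖ := by
  rw [Qhat_eq_norm_average_sq, Qhat_eq_norm_average_sq] at h
  exact (sq_le_sq₀ (norm_nonneg _) (norm_nonneg _)).1 h

theorem norm_vec_two_le (v : Vec 2) : ‖v‖ ≤ |v 0| + |v 1| := by
  rw [EuclideanSpace.norm_eq, Fin.sum_univ_two, Real.norm_eq_abs, Real.norm_eq_abs]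
  refine Real.sqrt_le_iff.2 ⟨by positivity, ?_⟩
  nlinarith [abs_nonneg (v 0), abs_nonneg (v 1)]

theorem abs_le_one_add_of_sq_le {a b : ℝ} (h : a ^ 2 ≤ b) : |a| ≤ 1 + b := by
  rw [← sq_abs] at h
  nlinarith [sq_nonneg (|a| - 1)]

theorem ConsistencyConditions.exists_mPsi_envelope [IsProbabilityMeasure P]
    (hC : ConsistencyConditions M P β₀ γs ξs B) :
    ∃ H : Obs d → ℝ, Integrable H P ∧ ∀ᵐ o ∂P, ∀ β ∈ B, ‖mPsi M P β₀ o β‖ ≤ H o := by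
  obtain ⟨G₁, hG₁, h₁⟩ := hC.moment_psiMu
  obtain ⟨G₂, hG₂, h₂⟩ := hC.moment_psiSigma
  refine ⟨fun o => (1 + G₁ o + |constA M P β₀|) + (1 + G₂ o + |constB M P β₀|), by fun_prop, ?_⟩
  filter_upwards [h₁, h₂] with o ho₁ ho₂ β hβ
  refine (norm_vec_two_le _).trans (add_le_add ?_ ?_)
  · refine (abs_sub _ _).trans ?_
    gcongr
    have := ho₁ β hβ
    rw [sq_abs] at this
    exact abs_le_one_add_of_sq_le this
  · refine (abs_sub _ _).trans ?_
    gcongr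
    have := ho₂ β hβ
    rw [sq_abs] at this
    exact abs_le_one_add_of_sq_le this

/-- Overlap bounds both weights in `phi` by `ε⁻¹`; the one on `h` also needs `π ≤ 1`, which gives
`|R - π| ≤ 1`. -/
theorem ConsistencyConditions.exists_phi_envelope [IsProbabilityMeasure P]
    (hC : ConsistencyConditions M P β₀ γs ξs B) :
    ∃ H : Obs d → ℝ, Integrable H P ∧ ∀ᵐ o ∂P, ∀ β ∈ B, ‖phi M P β₀ o β γs ξs‖ ≤ H o := by
  obtain ⟨G, hG, h⟩ := hC.exists_mPsi_envelope
  obtain ⟨G₀, hG₀, h₀⟩ := hC.moment_h 0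
  obtain ⟨G₁, hG₁, h₁⟩ := hC.moment_h 1
  obtain ⟨ε, hε, hov⟩ := hC.overlap
  refine ⟨fun o => ε⁻¹ * G o + ε⁻¹ * ((1 + G₀ o) + (1 + G₁ o)), by fun_prop, ?_⟩
  filter_upwards [h, h₀, h₁, hov] with o ho ho₀ ho₁ hπ β hβ
  have hπpos := M.prop_pos (z1 o) γs
  have hinv : (M.prop (z1 o) γs)⁻¹ ≤ ε⁻¹ := inv_anti₀ hε hπ.1.le
  have w1 : |rInd o / M.prop (z1 o) γs| ≤ ε⁻¹ := by
    rw [abs_div, abs_of_pos hπpos, div_eq_mul_inv]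
    refine le_trans (mul_le_of_le_one_left (by positivity) ?_) hinv
    rcases rInd_eq_zero_or_one o with h | h <;> simp [h]
  have w2 : |(rInd o - M.prop (z1 o) γs) / M.prop (z1 o) γs| ≤ ε⁻¹ := by
    rw [abs_div, abs_of_pos hπpos, div_eq_mul_inv]
    refine le_trans (mul_le_of_le_one_left (by positivity) ?_) hinv
    rcases rInd_eq_zero_or_one o with h | h <;> rw [h, abs_le] <;> constructor <;> linarith [hπ.2]
  have hh : ‖M.h (z1 o) β ξs‖ ≤ (1 + G₀ o) + (1 + G₁ o) :=
    (norm_vec_two_le _).trans (add_le_add (abs_le_one_add_of_sq_le (ho₀ β hβ))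
      (abs_le_one_add_of_sq_le (ho₁ β hβ)))
  refine (norm_sub_le _ _).trans ?_
  rw [norm_smul, norm_smul, Real.norm_eq_abs, Real.norm_eq_abs]
  have := ho β hβ
  gcongr

theorem ConsistencyConditions.ae_continuousWithinAt_mPsi
    (hC : ConsistencyConditions M P β₀ γs ξs B) {β : Vec 2} (hβ : β ∈ B) :
    ∀ᵐ o ∂P, ContinuousWithinAt (mPsi M P β₀ o) B β := by
  filter_upwards [hC.continuous_psi β hβ] with o ho
  refine (PiLp.continuous_toLp 2 _).continuousAt.comp_continuousWithinAt
    (continuousWithinAt_pi.2 fun k => ?_)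
  fin_cases k
  · exact ho.1.sub continuousWithinAt_const
  · exact (ho.2.pow 2).sub continuousWithinAt_const

theorem continuousWithinAt_phi {o : Obs d} {β : Vec 2}
    (h1 : ContinuousWithinAt (mPsi M P β₀ o) B β)
    (h2 : ContinuousWithinAt (fun b => M.h (z1 o) b ξs) B β) :
    ContinuousWithinAt (fun b => phi M P β₀ o b γs ξs) B β := by
  have h3 := h1.const_smul (rInd o / M.prop (z1 o) γs)
  have h4 := h2.const_smul ((rInd o - M.prop (z1 o) γs) / M.prop (z1 o) γs)
  exact h3.sub h4

theorem ConsistencyConditions.ae_continuousWithinAt_phi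
    (hC : ConsistencyConditions M P β₀ γs ξs B) {β : Vec 2} (hβ : β ∈ B) :
    ∀ᵐ o ∂P, ContinuousWithinAt (fun b => phi M P β₀ o b γs ξs) B β := by
  have e1 := hC.ae_continuousWithinAt_mPsi hβ
  have e2 := hC.continuous_h β hβ
  filter_upwards [e1, e2] with o h1 h2
  exact continuousWithinAt_phi h1 h2

/-- The sample average of the estimating function is asymptotically insensitive, uniformly in the
parameter of interest, to the estimation of the nuisance parameters. -/
theorem ConsistencyConditions.eventuallyLikely_nuisance {Ω : Type*} [MeasurableSpace Ω]
    {Pr : Measure Ω} [IsProbabilityMeasure Pr] [IsProbabilityMeasure P]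
    (hC : ConsistencyConditions M P β₀ γs ξs B)
    {O : ℕ → Ω → Obs d} (hlaw : ∀ i, HasLaw (O i) P Pr) (hindep : iIndepFun O Pr)
    {γhat : ℕ → Ω → Vec p} {ξhat : ℕ → Ω → Vec q}
    (hγlim : TendstoInMeasure Pr γhat atTop fun _ => γs)
    (hξlim : TendstoInMeasure Pr ξhat atTop fun _ => ξs) {ε : ℝ} (hε : 0 < ε) :
    EventuallyLikely Pr fun n ω => ∀ β ∈ B,
      ‖(n : ℝ)⁻¹ • ∑ i ∈ Finset.range n, phi M P β₀ (O i ω) β (γhat n ω) (ξhat n ω)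
        - (n : ℝ)⁻¹ • ∑ i ∈ Finset.range n, phi M P β₀ (O i ω) β γs ξs‖ < ε := by
  obtain ⟨U, V, hU, hγU, hV, hξV, hπ, hh, ⟨G₁, hG₁, h₁⟩, ⟨G₂, hG₂, h₂⟩⟩ := hC.smooth_nuisance
  obtain ⟨r₁, hr₁, hr₁U⟩ := Metric.isOpen_iff.1 hU γs hγU
  obtain ⟨r₂, hr₂, hr₂V⟩ := Metric.isOpen_iff.1 hV ξs hξV
  -- Move `γ` to its limit with `ξ` fixed, then `ξ`; each move is a mean value inequality on a
  -- convex ball. The Lipschitz constant is integrable and the same for all `β`.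
  have hbound : ∀ᵐ o ∂P, ∀ β ∈ B, ∀ γ ∈ Metric.ball γs r₁, ∀ ξ ∈ Metric.ball ξs r₂,
      ‖phi M P β₀ o β γ ξ - phi M P β₀ o β γs ξs‖
        ≤ (|G₁ o| + |G₂ o|) * (‖γ - γs‖ + ‖ξ - ξs‖) := by
    filter_upwards [hπ, hh, h₁, h₂] with o hπo hho h₁o h₂o β hβ γ hγ ξ hξ
    have d1 : ∀ g ∈ Metric.ball γs r₁,
        DifferentiableAt ℝ (fun γ => phi M P β₀ o β γ ξ) g := by
      intro g hg
      have hd : DifferentiableAt ℝ (M.prop (z1 o)) g :=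
        (hπo.differentiableOn one_ne_zero).differentiableAt (hU.mem_nhds (hr₁U hg))
      have h0 := (M.prop_pos (z1 o) g).ne'
      have hi : DifferentiableAt ℝ (fun γ => (M.prop (z1 o) γ)⁻¹) g := hd.fun_inv h0
      simp only [phi, div_eq_mul_inv]
      fun_prop
    have d2 : ∀ g ∈ Metric.ball ξs r₂,
        DifferentiableAt ℝ (fun ξ => phi M P β₀ o β γs ξ) g := by
      intro g hg
      have hd : DifferentiableAt ℝ (M.h (z1 o) β) g :=
        ((hho β hβ).differentiableOn one_ne_zero).differentiableAt (hV.mem_nhds (hr₂V hg))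
      unfold phi
      fun_prop
    have e1 := (convex_ball γs r₁).norm_image_sub_le_of_norm_fderiv_le (𝕜 := ℝ) d1
      (C := |G₁ o|) (fun g hg => (h₁o (β, g, ξ) ⟨hβ, hr₁U hg, hr₂V hξ⟩).trans (le_abs_self _))
      (Metric.mem_ball_self hr₁) hγ
    have e2 := (convex_ball ξs r₂).norm_image_sub_le_of_norm_fderiv_le (𝕜 := ℝ) d2
      (C := |G₂ o|) (fun g hg => (h₂o (β, γs, g) ⟨hβ, hγU, hr₂V hg⟩).trans (le_abs_self _))
      (Metric.mem_ball_self hr₂) hξ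
    calc ‖phi M P β₀ o β γ ξ - phi M P β₀ o β γs ξs‖
        ≤ ‖phi M P β₀ o β γ ξ - phi M P β₀ o β γs ξ‖
          + ‖phi M P β₀ o β γs ξ - phi M P β₀ o β γs ξs‖ := norm_sub_le_norm_sub_add_norm_sub _ _ _
      _ ≤ |G₁ o| * ‖γ - γs‖ + |G₂ o| * ‖ξ - ξs‖ := add_le_add e1 e2
      _ ≤ (|G₁ o| + |G₂ o|) * (‖γ - γs‖ + ‖ξ - ξs‖) := by
        nlinarith [mul_nonneg (abs_nonneg (G₁ o)) (norm_nonneg (ξ - ξs)),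
          mul_nonneg (abs_nonneg (G₂ o)) (norm_nonneg (γ - γs))]
  set C : ℝ := ∫ o, (|G₁ o| + |G₂ o|) ∂P + 1 with hCdef
  have hCpos : 0 < C := by
    have : 0 ≤ ∫ o, (|G₁ o| + |G₂ o|) ∂P := integral_nonneg fun o => by positivity
    linarith
  -- With probability tending to one the averaged Lipschitz constant is below `C`, its mean plus
  -- one, and the two nuisance errors together are below `ε / C`.
  have hη : 0 < min (min r₁ r₂) (ε / (2 * C)) := by positivity
  refine ((eventuallyLikely_average hlaw hindep (hG₁.abs.add hG₂.abs) one_pos).and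
    ((eventuallyLikely_norm_sub_lt hγlim hη).and (eventuallyLikely_norm_sub_lt hξlim hη))).mono
    (Eventually.of_forall fun n => ?_)
  filter_upwards [ae_forall_sample hlaw hbound] with ω hω ⟨havg, hγ, hξ⟩ β hβ
  rw [lt_min_iff, lt_min_iff] at hγ hξ
  have a1 := norm_average_sub_average_le (n := n) fun i => hω i β hβ (γhat n ω)
    (by rw [Metric.mem_ball, dist_eq_norm]; exact hγ.1.1) (ξhat n ω)
    (by rw [Metric.mem_ball, dist_eq_norm]; exact hξ.1.2)
  rw [← Finset.sum_mul, smul_eq_mul, ← mul_assoc] at a1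
  have a2 := (abs_lt.1 havg).2
  simp only [Pi.add_apply, smul_eq_mul] at a2
  refine a1.trans_lt ?_
  have a3 : ‖γhat n ω - γs‖ + ‖ξhat n ω - ξs‖ < ε / C := by
    have : ε / C = ε / (2 * C) + ε / (2 * C) := by field_simp; norm_num
    linarith [hγ.2, hξ.2]
  calc (n : ℝ)⁻¹ * (∑ i ∈ Finset.range n, (|G₁ (O i ω)| + |G₂ (O i ω)|))
        * (‖γhat n ω - γs‖ + ‖ξhat n ω - ξs‖)
      ≤ C * (‖γhat n ω - γs‖ + ‖ξhat n ω - ξs‖) := by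
        gcongr
        linarith
    _ < C * (ε / C) := by gcongr
    _ = ε := by field_simp

theorem ConsistencyConditions.tendstoInMeasure {Ω : Type*} [MeasurableSpace Ω]
    {Pr : Measure Ω} [IsProbabilityMeasure Pr] [IsProbabilityMeasure P]
    (hC : ConsistencyConditions M P β₀ γs ξs B)
    {O : ℕ → Ω → Obs d} (hlaw : ∀ i, HasLaw (O i) P Pr) (hindep : iIndepFun O Pr)
    (hMAR : MissingAtRandom P)
    {γhat : ℕ → Ω → Vec p} {ξhat : ℕ → Ω → Vec q} {βhat : ℕ → Ω → Vec 2}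
    (hβhat : EventuallyLikely Pr fun n ω => βhat n ω ∈ B ∧ ∀ β ∈ B,
      Qhat M P β₀ n (fun i => O i ω) (βhat n ω) (γhat n ω) (ξhat n ω) ≤
        Qhat M P β₀ n (fun i => O i ω) β (γhat n ω) (ξhat n ω))
    (hγlim : TendstoInMeasure Pr γhat atTop fun _ => γs)
    (hξlim : TendstoInMeasure Pr ξhat atTop fun _ => ξs)
    (hcorrect : PropensityCorrect M P γs ∨ OutcomeCorrect M P β₀ B ξs) :
    TendstoInMeasure Pr βhat atTop fun _ => β₀ := by
  obtain ⟨Hm, hHm, hmle⟩ := hC.exists_mPsi_envelope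
  obtain ⟨H, hH, hle⟩ := hC.exists_phi_envelope
  have hmmeas : ∀ β, Measurable fun o => mPsi M P β₀ o β := fun β =>
    (measurable_mPsi M P β₀).comp (measurable_id.prodMk measurable_const)
  have hphim : Measurable fun x : Obs d × Vec 2 => phi M P β₀ x.1 x.2 γs ξs :=
    (measurable_phi M P β₀).comp (f := fun x : Obs d × Vec 2 => (x.1, x.2, γs, ξs)) (by fun_prop)
  have hmint : ∀ β ∈ B, Integrable (fun o => mPsi M P β₀ o β) P := fun β hβ =>
    hHm.mono' (hmmeas β).aestronglyMeasurable (by filter_upwards [hmle] with o ho using ho β hβ)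
  have hphiint : ∀ β ∈ B, Integrable (fun o => phi M P β₀ o β γs ξs) P := fun β hβ =>
    hH.mono' (hphim.comp (measurable_id.prodMk measurable_const)).aestronglyMeasurable
      (by filter_upwards [hle] with o ho using ho β hβ)
  have hmean : ∀ β ∈ B, ∫ o, phi M P β₀ o β γs ξs ∂P = ∫ o, mPsi M P β₀ o β ∂P := fun β hβ =>
    integral_phi_eq_integral_mPsi hMAR hcorrect hβ (hphiint β hβ) (hmint β hβ)
  -- This is what the centring constants `constA` and `constB` are for.
  have hzero : ∫ o, mPsi M P β₀ o β₀ ∂P = 0 := by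
    have hm0 := hmint β₀ hC.mem
    ext k
    have h1 := (EuclideanSpace.proj k : Vec 2 →L[ℝ] ℝ).integral_comp_comm hm0
    have h2 := (EuclideanSpace.proj k : Vec 2 →L[ℝ] ℝ).integrable_comp hm0
    simp only [EuclideanSpace.coe_proj] at h1 h2
    rw [← h1]
    fin_cases k
    · have h3 : Integrable (fun o : Obs d => M.psi M.cMu ((z2 o - β₀ 0) / β₀ 1)) P := by
        have := h2.add (integrable_const (constA M P β₀))
        refine this.congr (ae_of_all _ fun o => ?_)
        simp [mPsi]
      have := integral_sub h3 (integrable_const (constA M P β₀))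
      simpa [constA, mPsi] using this
    · have h3 : Integrable (fun o : Obs d => M.psi M.cSigma ((z2 o - β₀ 0) / β₀ 1) ^ 2) P := by
        have := h2.add (integrable_const (constB M P β₀))
        refine this.congr (ae_of_all _ fun o => ?_)
        simp [mPsi]
      have := integral_sub h3 (integrable_const (constB M P β₀))
      simpa [constB, mPsi] using this
  have hcontm : ContinuousOn (fun β => ∫ o, mPsi M P β₀ o β ∂P) B := by
    intro β hβ
    refine continuousWithinAt_of_dominated (bound := Hm)
      (Eventually.of_forall fun β => (hmmeas β).aestronglyMeasurable) ?_ hHm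
      (hC.ae_continuousWithinAt_mPsi hβ)
    filter_upwards [self_mem_nhdsWithin] with β' hβ'
    filter_upwards [hmle] with o ho using ho β' hβ'
  refine tendstoInMeasure_of_eventuallyLikely fun ε hε => ?_
  -- Identification becomes quantitative: on the compact set `B` minus a ball, the continuous norm
  -- of the mean attains a minimum, which is positive.
  obtain ⟨η, hη, hsep⟩ : ∃ η > 0, ∀ β ∈ B, ‖∫ o, mPsi M P β₀ o β ∂P‖ < η → ‖β - β₀‖ < ε := by
    have hK : IsCompact (B \ Metric.ball β₀ ε) := hC.compact.diff Metric.isOpen_ball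
    rcases (B \ Metric.ball β₀ ε).eq_empty_or_nonempty with hemp | hne
    · refine ⟨1, one_pos, fun β hβ _ => ?_⟩
      by_contra hcon
      have : β ∈ B \ Metric.ball β₀ ε := ⟨hβ, by rwa [Metric.mem_ball, dist_eq_norm]⟩
      rw [hemp] at this
      exact this
    · obtain ⟨b, hb, hmin⟩ := hK.exists_isMinOn hne
        (hcontm.mono Set.sdiff_subset).norm
      refine ⟨‖∫ o, mPsi M P β₀ o b ∂P‖, norm_pos_iff.2 fun h0 => hb.2 ?_, fun β hβ hlt => ?_⟩
      · rw [hC.identification b hb.1 h0]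
        exact Metric.mem_ball_self hε
      · by_contra hcon
        have hβ' : β ∈ B \ Metric.ball β₀ ε := ⟨hβ, by rwa [Metric.mem_ball, dist_eq_norm]⟩
        exact absurd (hmin hβ') (not_le.2 hlt)
  refine ((hβhat.and (hC.eventuallyLikely_nuisance hlaw hindep hγlim hξlim
    (show 0 < η / 4 by linarith))).and (eventuallyLikely_uniform_average hlaw hindep hphim
    hC.compact hH hle (fun β hβ => hC.ae_continuousWithinAt_phi hβ)
    (show 0 < η / 4 by linarith))).mono (Eventually.of_forall fun n => ae_of_all _ fun ω => ?_)
  rintro ⟨⟨⟨hmem, hmin⟩, hnuis⟩, hunif⟩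
  refine hsep _ hmem ?_
  have a1 := norm_average_le_of_Qhat_le (hmin β₀ hC.mem)
  have a2 := hnuis _ hmem
  have a3 := hnuis _ hC.mem
  have a4 := hunif _ hmem
  have a5 := hunif _ hC.mem
  rw [hmean _ hmem] at a4
  rw [hmean _ hC.mem, hzero, sub_zero] at a5
  set x := (n : ℝ)⁻¹ • ∑ i ∈ Finset.range n, phi M P β₀ (O i ω) (βhat n ω) (γhat n ω) (ξhat n ω)
  set y := (n : ℝ)⁻¹ • ∑ i ∈ Finset.range n, phi M P β₀ (O i ω) (βhat n ω) γs ξs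
  set x' := (n : ℝ)⁻¹ • ∑ i ∈ Finset.range n, phi M P β₀ (O i ω) β₀ (γhat n ω) (ξhat n ω)
  set y' := (n : ℝ)⁻¹ • ∑ i ∈ Finset.range n, phi M P β₀ (O i ω) β₀ γs ξs
  -- The mean at `βhat` is compared with `y`, then `x`, then by minimality with `x'`, and `x'` with
  -- `y'`, which is near zero: four errors below `η / 4`.
  have b1 : ‖x'‖ ≤ ‖x' - y'‖ + ‖y'‖ := norm_le_norm_sub_add _ _
  have b2 : ‖∫ o, mPsi M P β₀ o (βhat n ω) ∂P‖ ≤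
      ‖y - ∫ o, mPsi M P β₀ o (βhat n ω) ∂P‖ + ‖y‖ := by
    rw [norm_sub_rev]
    exact norm_le_norm_sub_add _ _
  have b3 : ‖y‖ ≤ ‖x - y‖ + ‖x‖ := by
    rw [norm_sub_rev]
    exact norm_le_norm_sub_add _ _
  linarith

end Consistency

/-! ### Stochastic strict differentiability and linearization of estimating equations. -/

section ZEstimation

variable {Ω α : Type*} [MeasurableSpace Ω] [MeasurableSpace α] {Pr : Measure Ω} {P : Measure α}
  {O : ℕ → Ω → α} {ι : Type*} [Fintype ι]

theorem sum_proj_smulRight_single [DecidableEq ι] {E : Type*} [NormedAddCommGroup E]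
    [NormedSpace ℝ E] (D : EuclideanSpace ℝ ι →L[ℝ] E) :
    ∑ i, (EuclideanSpace.proj i : EuclideanSpace ℝ ι →L[ℝ] ℝ).smulRight
      (D (EuclideanSpace.single i 1)) = D := by
  ext v
  have hv : v = ∑ i, v i • EuclideanSpace.single i (1 : ℝ) := by
    ext j
    simp [Finset.sum_apply, Pi.single_apply]
  conv_rhs => rw [hv, map_sum]
  simp

/-- A measurable version of the derivative, at a point, of a random differentiable function. -/
theorem exists_measurable_fderiv_version {F : α → EuclideanSpace ℝ ι → EuclideanSpace ℝ ι}
    (hF : Measurable fun x : α × EuclideanSpace ℝ ι => F x.1 x.2) {θ : EuclideanSpace ℝ ι}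
    (hd : ∀ᵐ o ∂P, DifferentiableAt ℝ (F o) θ) :
    ∃ J : α → EuclideanSpace ℝ ι →L[ℝ] EuclideanSpace ℝ ι, AEStronglyMeasurable J P ∧
      (∀ᵐ o ∂P, J o = fderiv ℝ (F o) θ) ∧
      Measurable fun x : α × EuclideanSpace ℝ ι => J x.1 x.2 := by
  classical
  have hw : ∀ i : ι, AEMeasurable (fun o => fderiv ℝ (F o) θ (EuclideanSpace.single i 1)) P := by
    intro i
    -- Directional derivatives are almost sure limits of measurable difference quotients with step
    -- `1 / n`.
    refine aemeasurable_of_tendsto_metrizable_ae atTop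
      (f := fun (n : ℕ) o => (n : ℝ) • (F o (θ + (n : ℝ)⁻¹ • EuclideanSpace.single i 1) - F o θ))
      (fun n => ?_) ?_
    · have hm : ∀ θ, Measurable fun o => F o θ := fun θ =>
        hF.comp (measurable_id.prodMk measurable_const)
      have h1 := hm (θ + (n : ℝ)⁻¹ • EuclideanSpace.single i 1)
      have h2 := hm θ
      fun_prop
    · filter_upwards [hd] with o ho
      exact ho.hasFDerivAt.lim _ (by simpa using tendsto_natCast_atTop_atTop)
  have hcont : ∀ i : ι, Continuous fun w : EuclideanSpace ℝ ι =>
      (EuclideanSpace.proj i : EuclideanSpace ℝ ι →L[ℝ] ℝ).smulRight w := fun i =>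
    (ContinuousLinearMap.smulRightL ℝ (EuclideanSpace ℝ ι) (EuclideanSpace ℝ ι)
      (EuclideanSpace.proj i)).continuous
  refine ⟨fun o => ∑ i, (EuclideanSpace.proj i : EuclideanSpace ℝ ι →L[ℝ] ℝ).smulRight
    ((hw i).mk _ o), ?_, ?_, ?_⟩
  · exact Finset.aestronglyMeasurable_fun_sum _ fun i _ =>
      (hcont i).comp_aestronglyMeasurable (hw i).measurable_mk.aestronglyMeasurable
  · filter_upwards [ae_all_iff.2 fun i => (hw i).ae_eq_mk] with o ho
    rw [← sum_proj_smulRight_single (fderiv ℝ (F o) θ)]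
    simp_rw [ho]
  · simp only [sum_apply, ContinuousLinearMap.smulRight_apply,
      EuclideanSpace.coe_proj]
    refine Finset.measurable_fun_sum _ fun i _ => ?_
    have := (hw i).measurable_mk
    fun_prop

theorem integrable_fderiv {F : α → EuclideanSpace ℝ ι → EuclideanSpace ℝ ι}
    (hF : Measurable fun x : α × EuclideanSpace ℝ ι => F x.1 x.2) {θ : EuclideanSpace ℝ ι}
    (hd : ∀ᵐ o ∂P, DifferentiableAt ℝ (F o) θ) {G : α → ℝ} (hG : Integrable G P)
    (hle : ∀ᵐ o ∂P, ‖fderiv ℝ (F o) θ‖ ≤ G o) : Integrable (fun o => fderiv ℝ (F o) θ) P := by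
  obtain ⟨J, hJm, hJ, -⟩ := exists_measurable_fderiv_version hF hd
  exact hG.mono' (hJm.congr hJ) hle

/-- Supplies the integrable envelope for the remainder quotient below. The diagonal `x = y` is
harmless, as division by zero gives zero. -/
theorem norm_image_sub_sub_div_le {E F : Type*} [NormedAddCommGroup E] [NormedSpace ℝ E]
    [NormedAddCommGroup F] [NormedSpace ℝ F] {f : E → F} {D : E →L[ℝ] F} {x y : E} {c C : ℝ}
    (hf : ‖f x - f y‖ ≤ c * ‖x - y‖) (hD : ‖D‖ ≤ C) (hcC : 0 ≤ c + C) :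
    ‖f x - f y - D (x - y)‖ / ‖x - y‖ ≤ c + C := by
  refine div_le_of_le_mul₀ (norm_nonneg _) hcC ?_
  refine (norm_sub_le _ _).trans ?_
  rw [add_mul]
  exact add_le_add hf ((D.le_opNorm _).trans (by gcongr))

/-- Averages of a random continuously differentiable function are, with probability tending to
one, strictly differentiable at the given point up to an arbitrarily small error. -/
theorem eventuallyLikely_average_strict_fderiv [StandardBorelSpace α]
    [IsProbabilityMeasure Pr] [IsProbabilityMeasure P]
    (hlaw : ∀ i, HasLaw (O i) P Pr) (hindep : iIndepFun O Pr)
    {F : α → EuclideanSpace ℝ ι → EuclideanSpace ℝ ι}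
    (hF : Measurable fun x : α × EuclideanSpace ℝ ι => F x.1 x.2) {θ₀ : EuclideanSpace ℝ ι}
    {N : Set (EuclideanSpace ℝ ι)} (hN : IsOpen N) (hθ₀ : θ₀ ∈ N)
    (hC1 : ∀ᵐ o ∂P, ContDiffOn ℝ 1 (F o) N) {G : α → ℝ} (hG : Integrable G P)
    (hle : ∀ᵐ o ∂P, ∀ θ ∈ N, ‖fderiv ℝ (F o) θ‖ ≤ G o) {η : ℝ} (hη : 0 < η) :
    ∃ δ > 0, EventuallyLikely Pr fun n ω => ∀ θ ∈ Metric.ball θ₀ δ, ∀ θ' ∈ Metric.ball θ₀ δ,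
      ‖(n : ℝ)⁻¹ • ∑ i ∈ Finset.range n, F (O i ω) θ
        - (n : ℝ)⁻¹ • ∑ i ∈ Finset.range n, F (O i ω) θ'
        - (∫ o, fderiv ℝ (F o) θ₀ ∂P) (θ - θ')‖ ≤ η * ‖θ - θ'‖ := by
  have hd : ∀ᵐ o ∂P, ∀ θ ∈ N, DifferentiableAt ℝ (F o) θ := by
    filter_upwards [hC1] with o ho θ hθ
    exact (ho.differentiableOn one_ne_zero).differentiableAt (hN.mem_nhds hθ)
  obtain ⟨J, hJm, hJ, hJmeas⟩ := exists_measurable_fderiv_version (P := P) hF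
    (θ := θ₀) (by filter_upwards [hd] with o ho using ho θ₀ hθ₀)
  have hJi : Integrable J P := by
    refine hG.mono' hJm ?_
    filter_upwards [hJ, hle] with o h1 h2
    rw [h1]
    exact h2 θ₀ hθ₀
  have hJint : ∫ o, fderiv ℝ (F o) θ₀ ∂P = ∫ o, J o ∂P :=
    integral_congr_ae (by filter_upwards [hJ] with o ho using ho.symm)
  obtain ⟨r, hr, hrN⟩ := Metric.isOpen_iff.1 hN θ₀ hθ₀
  let S : ℕ → Set (EuclideanSpace ℝ ι × EuclideanSpace ℝ ι) := fun k =>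
    Metric.ball θ₀ (r / ((k : ℝ) + 1)) ×ˢ Metric.ball θ₀ (r / ((k : ℝ) + 1))
  have hS0 : S 0 = Metric.ball θ₀ r ×ˢ Metric.ball θ₀ r := by simp [S]
  -- A `C¹` function is strictly differentiable, so its remainder quotient tends to zero uniformly
  -- over pairs of points in shrinking balls. With the envelope `2 G` its supremum is then small in
  -- mean.
  obtain ⟨k, ρ, hρ, hρη, hρle⟩ := exists_integrable_majorant_integral_lt P
    (g := fun o x => ‖F o x.1 - F o x.2 - J o (x.1 - x.2)‖ / ‖x.1 - x.2‖) (S := S)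
    (by
      have h1 : Measurable fun x : α × EuclideanSpace ℝ ι × EuclideanSpace ℝ ι => F x.1 x.2.1 :=
        hF.comp (f := fun x : α × EuclideanSpace ℝ ι × EuclideanSpace ℝ ι => (x.1, x.2.1))
          (by fun_prop)
      have h2 : Measurable fun x : α × EuclideanSpace ℝ ι × EuclideanSpace ℝ ι => F x.1 x.2.2 :=
        hF.comp (f := fun x : α × EuclideanSpace ℝ ι × EuclideanSpace ℝ ι => (x.1, x.2.2))
          (by fun_prop)
      have h3 : Measurable fun x : α × EuclideanSpace ℝ ι × EuclideanSpace ℝ ι =>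
          J x.1 (x.2.1 - x.2.2) :=
        hJmeas.comp (f := fun x : α × EuclideanSpace ℝ ι × EuclideanSpace ℝ ι =>
          (x.1, x.2.1 - x.2.2)) (by fun_prop)
      fun_prop)
    (fun k => measurableSet_ball.prod measurableSet_ball)
    (fun a b hab => by
      have : r / ((b : ℝ) + 1) ≤ r / ((a : ℝ) + 1) := by gcongr
      exact Set.prod_mono (Metric.ball_subset_ball this) (Metric.ball_subset_ball this))
    (hG.add hG)
    (by
      filter_upwards [hJ, hd, hle] with o h1 h2 h3 x hx
      rw [hS0] at hx
      have hJo : ‖J o‖ ≤ G o := h1 ▸ h3 θ₀ hθ₀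
      refine norm_image_sub_sub_div_le ?_ hJo (by linarith [norm_nonneg (J o)])
      exact (convex_ball θ₀ r).norm_image_sub_le_of_norm_fderiv_le (𝕜 := ℝ)
        (fun θ hθ => h2 θ (hrN hθ)) (fun θ hθ => h3 θ (hrN hθ)) hx.2 hx.1)
    (by
      filter_upwards [hJ, hC1] with o h1 h2 ε hε
      have hstrict := (h2.contDiffAt (hN.mem_nhds hθ₀)).hasStrictFDerivAt one_ne_zero
      have hev := hstrict.isLittleO.bound hε
      obtain ⟨s, hs, hs'⟩ := Metric.eventually_nhds_iff_ball.1 hev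
      obtain ⟨k, hk⟩ := exists_nat_one_div_lt (div_pos hs hr)
      have hk' : r / ((k : ℝ) + 1) < s := by
        rw [lt_div_iff₀ hr] at hk
        calc r / ((k : ℝ) + 1) = 1 / ((k : ℝ) + 1) * r := by ring
          _ < s := hk
      refine ⟨k, fun x hx => ?_⟩
      have hxs : x ∈ Metric.ball (θ₀, θ₀) s := by
        rw [← ball_prod_same]
        exact Set.prod_mono (Metric.ball_subset_ball hk'.le) (Metric.ball_subset_ball hk'.le) hx
      rw [h1]
      exact div_le_of_le_mul₀ (norm_nonneg _) hε.le (hs' x hxs))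
    (show 0 < η / 4 by linarith)
  refine ⟨r / ((k : ℝ) + 1), by positivity, ?_⟩
  refine ((eventuallyLikely_average hlaw hindep hρ (show 0 < η / 4 by linarith)).and
    (eventuallyLikely_average hlaw hindep hJi (show 0 < η / 4 by linarith))).mono
    (Eventually.of_forall fun n => ?_)
  filter_upwards [ae_forall_sample hlaw hρle] with ω hω ⟨h1, h2⟩ θ hθ θ' hθ'
  rw [hJint]
  have a1 : ∀ i, ‖(F (O i ω) θ - F (O i ω) θ') - J (O i ω) (θ - θ')‖
      ≤ ρ (O i ω) * ‖θ - θ'‖ := by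
    intro i
    rcases eq_or_ne θ θ' with rfl | hne
    · simp
    · exact (div_le_iff₀ (norm_pos_iff.2 (sub_ne_zero.2 hne))).1 (hω i (θ, θ') ⟨hθ, hθ'⟩)
  have a2 := norm_average_sub_average_le (n := n) a1
  rw [← Finset.sum_mul, smul_eq_mul, ← mul_assoc] at a2
  have a3 := (abs_lt.1 h1).2
  rw [smul_eq_mul] at a3
  have a4 := ContinuousLinearMap.le_opNorm
    ((n : ℝ)⁻¹ • ∑ i ∈ Finset.range n, J (O i ω) - ∫ o, J o ∂P) (θ - θ')
  have e1 : ((n : ℝ)⁻¹ • ∑ i ∈ Finset.range n, J (O i ω) - ∫ o, J o ∂P) (θ - θ')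
      = (n : ℝ)⁻¹ • ∑ i ∈ Finset.range n, J (O i ω) (θ - θ') - (∫ o, J o ∂P) (θ - θ') := by
    simp
  rw [e1] at a4
  rw [Finset.sum_sub_distrib, smul_sub] at a2
  have a5 := norm_add_le_of_le a2 a4
  rw [sub_add_sub_cancel] at a5
  refine a5.trans ?_
  rw [← add_mul]
  gcongr
  linarith

/-- Convergence in law gives boundedness in probability: the limit law puts little mass on the
closed set `K ≤ ‖x‖` for large `K`, and the portmanteau theorem transfers this bound. -/
theorem exists_eventually_measure_norm_ge_lt [IsProbabilityMeasure Pr] {E : Type*}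
    [NormedAddCommGroup E] [MeasurableSpace E] [BorelSpace E] {Ω' : Type*} [MeasurableSpace Ω']
    {ν : Measure Ω'} [IsProbabilityMeasure ν] {X : ℕ → Ω → E} {Z : Ω' → E}
    (h : TendstoInDistribution X atTop Z (fun _ => Pr) ν) {ε : ENNReal} (hε : 0 < ε) :
    ∃ K > 0, ∀ᶠ n in atTop, Pr {ω | K ≤ ‖X n ω‖} < ε := by
  have hcl : ∀ K : ℝ, IsClosed {x : E | K ≤ ‖x‖} := fun K =>
    isClosed_le continuous_const continuous_norm
  have hanti : Antitone fun k : ℕ => {x : E | (k : ℝ) ≤ ‖x‖} := fun a b hab x hx => by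
    have : (a : ℝ) ≤ b := Nat.cast_le.2 hab
    exact this.trans hx
  have : IsProbabilityMeasure (ν.map Z) := Measure.isProbabilityMeasure_map h.aemeasurable_limit
  have hlim := tendsto_measure_iInter_atTop (μ := ν.map Z)
    (fun k : ℕ => (hcl (k : ℝ)).measurableSet.nullMeasurableSet) hanti ⟨0, measure_ne_top _ _⟩
  have hempty : ⋂ k : ℕ, {x : E | (k : ℝ) ≤ ‖x‖} = ∅ := by
    refine Set.eq_empty_of_forall_notMem fun x hx => ?_
    obtain ⟨k, hk⟩ := exists_nat_gt ‖x‖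
    exact absurd (Set.mem_iInter.1 hx k) (not_le.2 hk)
  rw [hempty, measure_empty] at hlim
  obtain ⟨k, hk, hk0⟩ := ((hlim.eventually_lt_const hε).and (eventually_gt_atTop 0)).exists
  refine ⟨k, by exact_mod_cast hk0, ?_⟩
  have hport := ProbabilityMeasure.limsup_measure_closed_le_of_tendsto h.tendsto (hcl (k : ℝ))
  have := eventually_lt_of_limsup_lt (hport.trans_lt hk)
  filter_upwards [this] with n hn
  simpa [Measure.map_apply_of_aemeasurable (h.forall_aemeasurable n) (hcl (k : ℝ)).measurableSet]
    using hn

/-- Asymptotic linearity of a consistent approximate zero of averaged estimating functions. -/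
theorem tendstoInMeasure_linearization [IsProbabilityMeasure Pr] {E : Type*}
    [NormedAddCommGroup E] [NormedSpace ℝ E] [MeasurableSpace E] [BorelSpace E] {A : ℕ → Ω → E → E} {θ₀ : E} {L Linv : E →L[ℝ] E}
    (hinv : ∀ x, Linv (L x) = x)
    (hstrict : ∀ η > 0, ∃ δ > 0, EventuallyLikely Pr fun n ω =>
      ∀ θ ∈ Metric.ball θ₀ δ, ∀ θ' ∈ Metric.ball θ₀ δ,
        ‖A n ω θ - A n ω θ' - L (θ - θ')‖ ≤ η * ‖θ - θ'‖)
    {θhat : ℕ → Ω → E} (hlim : ∀ ε > 0, EventuallyLikely Pr fun n ω => ‖θhat n ω - θ₀‖ < ε)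
    (hzero : EventuallyLikely Pr fun n ω => A n ω (θhat n ω) = 0)
    {Ω' : Type*} [MeasurableSpace Ω'] {ν : Measure Ω'} [IsProbabilityMeasure ν] {Z : Ω' → E}
    (hclt : TendstoInDistribution (fun (n : ℕ) ω => Real.sqrt n • A n ω θ₀) atTop Z
      (fun _ => Pr) ν) :
    TendstoInMeasure Pr
      (fun (n : ℕ) ω => Real.sqrt n • (θhat n ω - θ₀) + Linv (Real.sqrt n • A n ω θ₀)) atTop
      fun _ => 0 := by
  refine tendstoInMeasure_of_eventuallyLikely fun ε hε => ?_
  simp only [sub_zero]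
  refine ENNReal.tendsto_nhds_zero.2 fun τ hτ => ?_
  obtain ⟨K, hK, hKn⟩ := exists_eventually_measure_norm_ge_lt hclt (ENNReal.half_pos hτ.ne')
  set C : ℝ := ‖Linv‖ + 1 with hC
  have hCpos : 0 < C := by positivity
  -- The first bound allows the remainder to be absorbed, giving `‖t‖ ≤ 2 C ‖A n ω θ₀‖`. The second
  -- brings the final error `2 C² η K` below `ε`.
  set η : ℝ := min (1 / (2 * C)) (ε / (2 * C ^ 2 * K)) with hηdef
  have hη : 0 < η := by positivity
  obtain ⟨δ, hδ, hδs⟩ := hstrict η hη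
  have hgood := (hδs.and (hlim δ hδ)).and hzero
  filter_upwards [hKn, hgood.eventually_lt_const (ENNReal.half_pos hτ.ne')] with n hn1 hn2
  rw [← ENNReal.add_halves τ]
  refine (measure_mono fun ω hω => ?_).trans
    ((measure_union_le _ _).trans (add_le_add hn1.le hn2.le))
  by_contra hcon
  simp only [Set.mem_union, Set.mem_ofPred_eq, not_or, not_not, not_le] at hcon
  obtain ⟨hS, ⟨hst, hclose⟩, hz⟩ := hcon
  refine hω ?_
  set t := θhat n ω - θ₀ with ht
  have b1 := hst (θhat n ω) (by rwa [Metric.mem_ball, dist_eq_norm]) θ₀ (Metric.mem_ball_self hδ)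
  rw [hz, zero_sub, ← ht, ← neg_add', norm_neg] at b1
  have b2 : t + Linv (A n ω θ₀) = Linv (A n ω θ₀ + L t) := by
    rw [map_add, hinv, add_comm]
  have b3 : ‖t + Linv (A n ω θ₀)‖ ≤ C * (η * ‖t‖) := by
    rw [b2]
    refine (Linv.le_opNorm _).trans ?_
    gcongr
    linarith
  have hCη : C * η ≤ 1 / 2 := by
    calc C * η ≤ C * (1 / (2 * C)) := by gcongr; exact min_le_left _ _
      _ = 1 / 2 := by field_simp
  have b4 : ‖t‖ ≤ 2 * C * ‖A n ω θ₀‖ := by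
    have c1 : ‖t‖ ≤ ‖t + Linv (A n ω θ₀)‖ + ‖Linv (A n ω θ₀)‖ := by
      simpa using norm_sub_le (t + Linv (A n ω θ₀)) (Linv (A n ω θ₀))
    have c2 : ‖Linv (A n ω θ₀)‖ ≤ C * ‖A n ω θ₀‖ := by
      refine (Linv.le_opNorm _).trans ?_
      gcongr
      linarith
    have c3 : C * (η * ‖t‖) ≤ 1 / 2 * ‖t‖ := by
      rw [← mul_assoc]
      gcongr
    linarith
  have hsq : 0 ≤ Real.sqrt n := Real.sqrt_nonneg _
  rw [map_smul, ← smul_add, norm_smul, Real.norm_of_nonneg hsq]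
  rw [norm_smul, Real.norm_of_nonneg hsq] at hS
  calc Real.sqrt n * ‖t + Linv (A n ω θ₀)‖
      ≤ Real.sqrt n * (C * (η * (2 * C * ‖A n ω θ₀‖))) := by
        refine mul_le_mul_of_nonneg_left (b3.trans ?_) hsq
        gcongr
    _ = 2 * C ^ 2 * η * (Real.sqrt n * ‖A n ω θ₀‖) := by ring
    _ < 2 * C ^ 2 * η * K := by gcongr
    _ ≤ 2 * C ^ 2 * (ε / (2 * C ^ 2 * K)) * K := by gcongr; exact min_le_right _ _
    _ = ε := by field_simp

end ZEstimation

/-! ### Block decomposition of the stacked parameter space. -/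

section Blocks

variable {d p q : ℕ}

/-- `betaPart` as a continuous linear map. -/
noncomputable def betaCLM (p q : ℕ) : Theta p q →L[ℝ] Vec 2 :=
  LinearMap.toContinuousLinearMap
    { toFun := betaPart, map_add' := fun _ _ => rfl, map_smul' := fun _ _ => rfl }

/-- `gammaPart` as a continuous linear map. -/
noncomputable def gammaCLM (p q : ℕ) : Theta p q →L[ℝ] Vec p :=
  LinearMap.toContinuousLinearMap
    { toFun := gammaPart, map_add' := fun _ _ => rfl, map_smul' := fun _ _ => rfl }

/-- `xiPart` as a continuous linear map. -/
noncomputable def xiCLM (p q : ℕ) : Theta p q →L[ℝ] Vec q :=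
  LinearMap.toContinuousLinearMap
    { toFun := xiPart, map_add' := fun _ _ => rfl, map_smul' := fun _ _ => rfl }

/-- `stack` as a continuous linear map. -/
noncomputable def stackCLM (p q : ℕ) : Vec 2 × Vec p × Vec q →L[ℝ] Theta p q :=
  LinearMap.toContinuousLinearMap
    { toFun := fun x => stack x.1 x.2.1 x.2.2
      map_add' := fun x y => by ext (k | k | k) <;> rfl
      map_smul' := fun c x => by ext (k | k | k) <;> rfl }

@[simp]
theorem gammaCLM_apply (θ : Theta p q) : gammaCLM p q θ = gammaPart θ := rfl

@[simp]
theorem xiCLM_apply (θ : Theta p q) : xiCLM p q θ = xiPart θ := rfl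

theorem stackCLM_apply (x : Vec 2 × Vec p × Vec q) :
    stackCLM p q x = stack x.1 x.2.1 x.2.2 := rfl

@[simp]
theorem betaPart_stack (β : Vec 2) (γ : Vec p) (ξ : Vec q) : betaPart (stack β γ ξ) = β := rfl

@[simp]
theorem gammaPart_stack (β : Vec 2) (γ : Vec p) (ξ : Vec q) : gammaPart (stack β γ ξ) = γ := rfl

@[simp]
theorem xiPart_stack (β : Vec 2) (γ : Vec p) (ξ : Vec q) : xiPart (stack β γ ξ) = ξ := rfl

@[simp]
theorem stack_parts (θ : Theta p q) : stack (betaPart θ) (gammaPart θ) (xiPart θ) = θ := by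
  ext (k | k | k) <;> rfl

theorem norm_stack_sq (β : Vec 2) (γ : Vec p) (ξ : Vec q) :
    ‖stack β γ ξ‖ ^ 2 = ‖β‖ ^ 2 + (‖γ‖ ^ 2 + ‖ξ‖ ^ 2) := by
  simp only [EuclideanSpace.real_norm_sq_eq, Fintype.sum_sum_type]
  rfl

theorem norm_betaPart_le (θ : Theta p q) : ‖betaPart θ‖ ≤ ‖θ‖ := by
  have h := norm_stack_sq (betaPart θ) (gammaPart θ) (xiPart θ)
  rw [stack_parts] at h
  refine (sq_le_sq₀ (norm_nonneg _) (norm_nonneg _)).1 ?_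
  rw [h]
  nlinarith [sq_nonneg ‖gammaPart θ‖, sq_nonneg ‖xiPart θ‖]

theorem norm_stack_zero_zero (β : Vec 2) : ‖stack β (0 : Vec p) (0 : Vec q)‖ = ‖β‖ := by
  have h := norm_stack_sq β (0 : Vec p) (0 : Vec q)
  refine (sq_eq_sq₀ (norm_nonneg _) (norm_nonneg _)).1 ?_
  simpa using h

theorem norm_stack_le (β : Vec 2) (γ : Vec p) (ξ : Vec q) :
    ‖stack β γ ξ‖ ≤ ‖β‖ + ‖γ‖ + ‖ξ‖ := by
  refine (sq_le_sq₀ (norm_nonneg _) (by positivity)).1 ?_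
  rw [norm_stack_sq]
  nlinarith [mul_nonneg (norm_nonneg β) (norm_nonneg γ), mul_nonneg (norm_nonneg β) (norm_nonneg ξ),
    mul_nonneg (norm_nonneg γ) (norm_nonneg ξ)]

theorem stack_sub_stack (β β' : Vec 2) (γ γ' : Vec p) (ξ ξ' : Vec q) :
    stack β γ ξ - stack β' γ' ξ' = stack (β - β') (γ - γ') (ξ - ξ') := by
  ext (k | k | k) <;> rfl

theorem single_inl (i : Fin 2) : (EuclideanSpace.single (Sum.inl i) 1 : Theta p q)
    = stack (EuclideanSpace.single i 1) 0 0 := by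
  ext (k | k | k) <;> simp [stack]

theorem single_inr_inl (i : Fin p) : (EuclideanSpace.single (Sum.inr (Sum.inl i)) 1 : Theta p q)
    = stack 0 (EuclideanSpace.single i 1) 0 := by
  ext (k | k | k) <;> simp [stack]

theorem single_inr_inr (i : Fin q) : (EuclideanSpace.single (Sum.inr (Sum.inr i)) 1 : Theta p q)
    = stack 0 0 (EuclideanSpace.single i 1) := by
  ext (k | k | k) <;> simp [stack]

theorem hasFDerivAt_stack_left (β : Vec 2) (γ : Vec p) (ξ : Vec q) :
    HasFDerivAt (fun b => stack b γ ξ)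
      ((stackCLM p q).comp (ContinuousLinearMap.inl ℝ (Vec 2) (Vec p × Vec q))) β := by
  have h := ((stackCLM p q).comp
    (ContinuousLinearMap.inl ℝ (Vec 2) (Vec p × Vec q))).hasFDerivAt (x := β)
  refine (h.add_const (stack 0 γ ξ)).congr_of_eventuallyEq (Eventually.of_forall fun b => ?_)
  ext (k | k | k) <;> simp [stackCLM_apply, stack]

theorem hasFDerivAt_stack_middle (β : Vec 2) (γ : Vec p) (ξ : Vec q) :
    HasFDerivAt (fun g => stack β g ξ)
      ((stackCLM p q).comp ((ContinuousLinearMap.inr ℝ (Vec 2) (Vec p × Vec q)).comp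
        (ContinuousLinearMap.inl ℝ (Vec p) (Vec q)))) γ := by
  have h := ((stackCLM p q).comp ((ContinuousLinearMap.inr ℝ (Vec 2) (Vec p × Vec q)).comp
    (ContinuousLinearMap.inl ℝ (Vec p) (Vec q)))).hasFDerivAt (x := γ)
  refine (h.add_const (stack β 0 ξ)).congr_of_eventuallyEq (Eventually.of_forall fun b => ?_)
  ext (k | k | k) <;> simp [stackCLM_apply, stack]

theorem hasFDerivAt_stack_right (β : Vec 2) (γ : Vec p) (ξ : Vec q) :
    HasFDerivAt (fun x => stack β γ x)
      ((stackCLM p q).comp ((ContinuousLinearMap.inr ℝ (Vec 2) (Vec p × Vec q)).comp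
        (ContinuousLinearMap.inr ℝ (Vec p) (Vec q)))) ξ := by
  have h := ((stackCLM p q).comp ((ContinuousLinearMap.inr ℝ (Vec 2) (Vec p × Vec q)).comp
    (ContinuousLinearMap.inr ℝ (Vec p) (Vec q)))).hasFDerivAt (x := ξ)
  refine (h.add_const (stack β γ 0)).congr_of_eventuallyEq (Eventually.of_forall fun b => ?_)
  ext (k | k | k) <;> simp [stackCLM_apply, stack]

end Blocks

/-! ### Blocks of the expected Jacobian, by the chain rule along coordinate slices. -/

section Jacobians

variable {d p q : ℕ} {M : Ingredients d p q} {P : Measure (Obs d)} {β₀ : Vec 2}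
  {γs : Vec p} {ξs : Vec q} {B : Set (Vec 2)}

theorem measurable_phiTilde :
    Measurable fun x : Obs d × Theta p q => phiTilde M P β₀ x.1 x.2 := by
  have hβ : Measurable (betaPart : Theta p q → Vec 2) := (betaCLM p q).measurable
  have hγ : Measurable (gammaPart : Theta p q → Vec p) := (gammaCLM p q).measurable
  have hξ : Measurable (xiPart : Theta p q → Vec q) := (xiCLM p q).measurable
  have h1 : Measurable fun x : Obs d × Theta p q =>
      phi M P β₀ x.1 (betaPart x.2) (gammaPart x.2) (xiPart x.2) :=
    (measurable_phi M P β₀).comp (f := fun x : Obs d × Theta p q =>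
      (x.1, betaPart x.2, gammaPart x.2, xiPart x.2)) (by fun_prop)
  have h2 : Measurable fun x : Obs d × Theta p q => obsMGamma M x.1 (gammaPart x.2) :=
    M.measurable_mGamma.comp (f := fun x : Obs d × Theta p q => (x.1.2.2, z1 x.1, gammaPart x.2))
      (by fun_prop)
  have h3 : Measurable fun x : Obs d × Theta p q => obsMXi M x.1 (xiPart x.2) := by
    have : Measurable fun x : Obs d × Theta p q => M.mXi (z1 x.1) (z2 x.1) (xiPart x.2) :=
      M.measurable_mXi.comp (f := fun x : Obs d × Theta p q => (z1 x.1, z2 x.1, xiPart x.2))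
        (by fun_prop)
    unfold obsMXi
    fun_prop
  exact (stackCLM p q).measurable.comp (h1.prodMk (h2.prodMk h3))

variable {o : Obs d}

theorem jacobian_phiTilde_beta_beta
    (h : DifferentiableAt ℝ (phiTilde M P β₀ o) (stack β₀ γs ξs)) (k i : Fin 2) :
    jacobian (phiTilde M P β₀ o) (stack β₀ γs ξs) (Sum.inl k) (Sum.inl i)
      = jacobian (fun β => phi M P β₀ o β γs ξs) β₀ k i := by
  have h1 := (betaCLM p q).hasFDerivAt.comp β₀
    (h.hasFDerivAt.comp β₀ (hasFDerivAt_stack_left β₀ γs ξs))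
  have h2 : (fun β => phi M P β₀ o β γs ξs)
      = betaCLM p q ∘ phiTilde M P β₀ o ∘ fun b => stack b γs ξs := rfl
  rw [jacobian, jacobian, Matrix.of_apply, Matrix.of_apply, h2, h1.fderiv, single_inl]
  rfl

theorem jacobian_phiTilde_beta_gamma
    (h : DifferentiableAt ℝ (phiTilde M P β₀ o) (stack β₀ γs ξs)) (k : Fin 2) (i : Fin p) :
    jacobian (phiTilde M P β₀ o) (stack β₀ γs ξs) (Sum.inl k) (Sum.inr (Sum.inl i))
      = jacobian (fun γ => phi M P β₀ o β₀ γ ξs) γs k i := by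
  have h1 := (betaCLM p q).hasFDerivAt.comp γs
    (h.hasFDerivAt.comp γs (hasFDerivAt_stack_middle β₀ γs ξs))
  have h2 : (fun γ => phi M P β₀ o β₀ γ ξs)
      = betaCLM p q ∘ phiTilde M P β₀ o ∘ fun g => stack β₀ g ξs := rfl
  rw [jacobian, jacobian, Matrix.of_apply, Matrix.of_apply, h2, h1.fderiv, single_inr_inl]
  rfl

theorem jacobian_phiTilde_beta_xi
    (h : DifferentiableAt ℝ (phiTilde M P β₀ o) (stack β₀ γs ξs)) (k : Fin 2) (i : Fin q) :
    jacobian (phiTilde M P β₀ o) (stack β₀ γs ξs) (Sum.inl k) (Sum.inr (Sum.inr i))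
      = jacobian (fun ξ => phi M P β₀ o β₀ γs ξ) ξs k i := by
  have h1 := (betaCLM p q).hasFDerivAt.comp ξs
    (h.hasFDerivAt.comp ξs (hasFDerivAt_stack_right β₀ γs ξs))
  have h2 : (fun ξ => phi M P β₀ o β₀ γs ξ)
      = betaCLM p q ∘ phiTilde M P β₀ o ∘ fun x => stack β₀ γs x := rfl
  rw [jacobian, jacobian, Matrix.of_apply, Matrix.of_apply, h2, h1.fderiv, single_inr_inr]
  rfl

/-- The `γ` equation does not involve `β`, so its slice is constant; the other zero blocks arise
likewise. -/
theorem jacobian_phiTilde_gamma_beta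
    (h : DifferentiableAt ℝ (phiTilde M P β₀ o) (stack β₀ γs ξs)) (k : Fin p) (i : Fin 2) :
    jacobian (phiTilde M P β₀ o) (stack β₀ γs ξs) (Sum.inr (Sum.inl k)) (Sum.inl i) = 0 := by
  have h1 := (gammaCLM p q).hasFDerivAt.comp β₀
    (h.hasFDerivAt.comp β₀ (hasFDerivAt_stack_left β₀ γs ξs))
  have h2 : gammaCLM p q ∘ phiTilde M P β₀ o ∘ (fun b => stack b γs ξs)
      = fun _ => obsMGamma M o γs := rfl
  have h3 := h1.fderiv
  rw [h2, fderiv_const_apply] at h3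
  rw [jacobian, Matrix.of_apply, single_inl]
  exact (congrArg (fun L : Vec 2 →L[ℝ] Vec p => L (EuclideanSpace.single i 1) k) h3).symm

theorem jacobian_phiTilde_gamma_gamma
    (h : DifferentiableAt ℝ (phiTilde M P β₀ o) (stack β₀ γs ξs)) (k i : Fin p) :
    jacobian (phiTilde M P β₀ o) (stack β₀ γs ξs) (Sum.inr (Sum.inl k)) (Sum.inr (Sum.inl i))
      = jacobian (obsMGamma M o) γs k i := by
  have h1 := (gammaCLM p q).hasFDerivAt.comp γs
    (h.hasFDerivAt.comp γs (hasFDerivAt_stack_middle β₀ γs ξs))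
  have h2 : obsMGamma M o
      = gammaCLM p q ∘ phiTilde M P β₀ o ∘ fun g => stack β₀ g ξs := rfl
  rw [jacobian, jacobian, Matrix.of_apply, Matrix.of_apply, h2, h1.fderiv, single_inr_inl]
  rfl

theorem jacobian_phiTilde_gamma_xi
    (h : DifferentiableAt ℝ (phiTilde M P β₀ o) (stack β₀ γs ξs)) (k : Fin p) (i : Fin q) :
    jacobian (phiTilde M P β₀ o) (stack β₀ γs ξs) (Sum.inr (Sum.inl k)) (Sum.inr (Sum.inr i))
      = 0 := by
  have h1 := (gammaCLM p q).hasFDerivAt.comp ξs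
    (h.hasFDerivAt.comp ξs (hasFDerivAt_stack_right β₀ γs ξs))
  have h2 : gammaCLM p q ∘ phiTilde M P β₀ o ∘ (fun x => stack β₀ γs x)
      = fun _ => obsMGamma M o γs := rfl
  have h3 := h1.fderiv
  rw [h2, fderiv_const_apply] at h3
  rw [jacobian, Matrix.of_apply, single_inr_inr]
  exact (congrArg (fun L : Vec q →L[ℝ] Vec p => L (EuclideanSpace.single i 1) k) h3).symm

theorem jacobian_phiTilde_xi_beta
    (h : DifferentiableAt ℝ (phiTilde M P β₀ o) (stack β₀ γs ξs)) (k : Fin q) (i : Fin 2) :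
    jacobian (phiTilde M P β₀ o) (stack β₀ γs ξs) (Sum.inr (Sum.inr k)) (Sum.inl i) = 0 := by
  have h1 := (xiCLM p q).hasFDerivAt.comp β₀
    (h.hasFDerivAt.comp β₀ (hasFDerivAt_stack_left β₀ γs ξs))
  have h2 : xiCLM p q ∘ phiTilde M P β₀ o ∘ (fun b => stack b γs ξs)
      = fun _ => obsMXi M o ξs := rfl
  have h3 := h1.fderiv
  rw [h2, fderiv_const_apply] at h3
  rw [jacobian, Matrix.of_apply, single_inl]
  exact (congrArg (fun L : Vec 2 →L[ℝ] Vec q => L (EuclideanSpace.single i 1) k) h3).symm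

theorem jacobian_phiTilde_xi_gamma
    (h : DifferentiableAt ℝ (phiTilde M P β₀ o) (stack β₀ γs ξs)) (k : Fin q) (i : Fin p) :
    jacobian (phiTilde M P β₀ o) (stack β₀ γs ξs) (Sum.inr (Sum.inr k)) (Sum.inr (Sum.inl i))
      = 0 := by
  have h1 := (xiCLM p q).hasFDerivAt.comp γs
    (h.hasFDerivAt.comp γs (hasFDerivAt_stack_middle β₀ γs ξs))
  have h2 : xiCLM p q ∘ phiTilde M P β₀ o ∘ (fun g => stack β₀ g ξs)
      = fun _ => obsMXi M o ξs := rfl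
  have h3 := h1.fderiv
  rw [h2, fderiv_const_apply] at h3
  rw [jacobian, Matrix.of_apply, single_inr_inl]
  exact (congrArg (fun L : Vec p →L[ℝ] Vec q => L (EuclideanSpace.single i 1) k) h3).symm

theorem jacobian_phiTilde_xi_xi
    (h : DifferentiableAt ℝ (phiTilde M P β₀ o) (stack β₀ γs ξs)) (k i : Fin q) :
    jacobian (phiTilde M P β₀ o) (stack β₀ γs ξs) (Sum.inr (Sum.inr k)) (Sum.inr (Sum.inr i))
      = jacobian (obsMXi M o) ξs k i := by
  have h1 := (xiCLM p q).hasFDerivAt.comp ξs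
    (h.hasFDerivAt.comp ξs (hasFDerivAt_stack_right β₀ γs ξs))
  have h2 : obsMXi M o
      = xiCLM p q ∘ phiTilde M P β₀ o ∘ fun x => stack β₀ γs x := rfl
  rw [jacobian, jacobian, Matrix.of_apply, Matrix.of_apply, h2, h1.fderiv, single_inr_inr]
  rfl

/-- The expected Jacobian matrix of the stacked estimating function is block upper triangular. -/
theorem expJacobian_phiTilde_eq_fromBlocks
    (h : ∀ᵐ o ∂P, DifferentiableAt ℝ (phiTilde M P β₀ o) (stack β₀ γs ξs)) :
    expJacobian P (phiTilde M P β₀) (stack β₀ γs ξs) = Matrix.fromBlocks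
      (expJacobian P (fun o β => phi M P β₀ o β γs ξs) β₀)
      (Matrix.fromCols (expJacobian P (fun o γ => phi M P β₀ o β₀ γ ξs) γs)
        (expJacobian P (fun o ξ => phi M P β₀ o β₀ γs ξ) ξs)) 0
      (Matrix.fromBlocks (expJacobian P (obsMGamma M) γs) 0 0 (expJacobian P (obsMXi M) ξs)) := by
  ext (k | k | k) (i | i | i)
  · exact integral_congr_ae (h.mono fun o ho => jacobian_phiTilde_beta_beta ho k i)
  · exact integral_congr_ae (h.mono fun o ho => jacobian_phiTilde_beta_gamma ho k i)
  · exact integral_congr_ae (h.mono fun o ho => jacobian_phiTilde_beta_xi ho k i)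
  · exact integral_eq_zero_of_ae (h.mono fun o ho => jacobian_phiTilde_gamma_beta ho k i)
  · exact integral_congr_ae (h.mono fun o ho => jacobian_phiTilde_gamma_gamma ho k i)
  · exact integral_eq_zero_of_ae (h.mono fun o ho => jacobian_phiTilde_gamma_xi ho k i)
  · exact integral_eq_zero_of_ae (h.mono fun o ho => jacobian_phiTilde_xi_beta ho k i)
  · exact integral_eq_zero_of_ae (h.mono fun o ho => jacobian_phiTilde_xi_gamma ho k i)
  · exact integral_congr_ae (h.mono fun o ho => jacobian_phiTilde_xi_xi ho k i)

/-- Links entrywise integrals, used in the influence function, with the operator-valued Bochner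
integral, used in the linearization. -/
theorem toEuclideanCLM_expJacobian {ι : Type*} [Fintype ι] [DecidableEq ι]
    {F : Obs d → EuclideanSpace ℝ ι → EuclideanSpace ℝ ι} {θ : EuclideanSpace ℝ ι}
    (hF : Integrable (fun o => fderiv ℝ (F o) θ) P) :
    Matrix.toEuclideanCLM (𝕜 := ℝ) (expJacobian P F θ) = ∫ o, fderiv ℝ (F o) θ ∂P := by
  rw [← sum_proj_smulRight_single (∫ o, fderiv ℝ (F o) θ ∂P),
    ← sum_proj_smulRight_single (Matrix.toEuclideanCLM (𝕜 := ℝ) (expJacobian P F θ))]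
  refine Finset.sum_congr rfl fun i _ => ?_
  congr 1
  ext k
  have h1 : (∫ o, fderiv ℝ (F o) θ ∂P) (EuclideanSpace.single i 1)
      = ∫ o, fderiv ℝ (F o) θ (EuclideanSpace.single i 1) ∂P :=
    ContinuousLinearMap.integral_apply hF _
  have h2 := (EuclideanSpace.proj k : EuclideanSpace ℝ ι →L[ℝ] ℝ).integral_comp_comm
    (hF.apply_continuousLinearMap (EuclideanSpace.single i 1))
  simp only [EuclideanSpace.coe_proj] at h2
  rw [h1, ← h2, Matrix.ofLp_toEuclideanCLM]
  simp [expJacobian, jacobian]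

end Jacobians

/-! ### Double robustness of the derivative and inversion of the expected Jacobian. -/

section Normality

variable {d p q : ℕ} {M : Ingredients d p q} {P : Measure (Obs d)} {β₀ : Vec 2}
  {γs : Vec p} {ξs : Vec q} {B : Set (Vec 2)}

theorem NormalityConditions.ae_differentiableAt (hN : NormalityConditions M P β₀ γs ξs B) :
    ∀ᵐ o ∂P, DifferentiableAt ℝ (phiTilde M P β₀ o) (stack β₀ γs ξs) := by
  obtain ⟨N, hNo, hmem, hC1, -⟩ := hN.smooth
  filter_upwards [hC1] with o ho
  exact (ho.differentiableOn one_ne_zero).differentiableAt (hNo.mem_nhds hmem)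

theorem NormalityConditions.integrable_fderiv_phiTilde
    (hN : NormalityConditions M P β₀ γs ξs B) :
    Integrable (fun o => fderiv ℝ (phiTilde M P β₀ o) (stack β₀ γs ξs)) P := by
  obtain ⟨N, -, hmem, -, G, hG, hle⟩ := hN.smooth
  exact integrable_fderiv measurable_phiTilde hN.ae_differentiableAt hG
    (by filter_upwards [hle] with o ho using ho _ hmem)

/-- Double robustness for derivatives: the estimating function has the expected derivative of the
full-data estimating function. -/
theorem NormalityConditions.expJacobian_phi_eq [IsProbabilityMeasure P]
    (hN : NormalityConditions M P β₀ γs ξs B) (hMAR : MissingAtRandom P)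
    (hcorrect : PropensityCorrect M P γs ∨ OutcomeCorrect M P β₀ B ξs) :
    expJacobian P (fun o β => phi M P β₀ o β γs ξs) β₀ = expJacobian P (mPsi M P β₀) β₀ := by
  obtain ⟨N, hNo, hmem, hC1, G, hG, hle⟩ := hN.smooth
  obtain ⟨r, hr, hrN⟩ := Metric.isOpen_iff.1 (hNo.inter isOpen_interior) (stack β₀ γs ξs)
    ⟨hmem, hN.interior_mem⟩
  obtain ⟨n₀, hn₀⟩ := exists_nat_one_div_lt hr
  ext k i
  -- The shift makes the step `(s n)⁻¹` smaller than `r` for every `n`, so all points `b n` lie in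
  -- `B` and all stacked points in the region where `G` dominates the derivative.
  let s : ℕ → ℝ := fun n => (n : ℝ) + (n₀ + 1)
  have hs : ∀ n, 0 < s n := fun n => by positivity
  let b : ℕ → Vec 2 := fun n => β₀ + (s n)⁻¹ • EuclideanSpace.single i 1
  have hsub : ∀ n, stack (b n) γs ξs - stack β₀ γs ξs
      = stack ((s n)⁻¹ • EuclideanSpace.single i 1) 0 0 := fun n => by
    rw [stack_sub_stack]
    simp [b]
  have hnorm : ∀ n, ‖stack (b n) γs ξs - stack β₀ γs ξs‖ = (s n)⁻¹ := fun n => by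
    rw [hsub, norm_stack_zero_zero, norm_smul, Real.norm_of_nonneg (inv_pos.2 (hs n)).le]
    simp
  have hball : ∀ n, stack (b n) γs ξs ∈ Metric.ball (stack β₀ γs ξs) r := fun n => by
    rw [Metric.mem_ball, dist_eq_norm, hnorm]
    refine lt_of_le_of_lt ?_ hn₀
    rw [one_div]
    refine inv_anti₀ (by positivity) ?_
    simp only [s]
    linarith [Nat.cast_nonneg (α := ℝ) n]
  have hbB : ∀ n, b n ∈ B := fun n => by
    have := interior_subset (hrN (hball n)).2
    simpa using this
  have hβ₀B : β₀ ∈ B := by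
    have := interior_subset hN.interior_mem
    simpa using this
  have hslim : Tendsto (fun n => ‖s n‖) atTop atTop :=
    tendsto_norm_atTop_atTop.comp (tendsto_atTop_add_const_right _ _ tendsto_natCast_atTop_atTop)
  have hquot : ∀ {f : Vec 2 → Vec 2}, DifferentiableAt ℝ f β₀ →
      Tendsto (fun n => s n * f (b n) k - s n * f β₀ k) atTop (𝓝 (jacobian f β₀ k i)) := by
    intro f hf
    have h1 := ((EuclideanSpace.proj k : Vec 2 →L[ℝ] ℝ).continuous.tendsto _).comp
      (hf.hasFDerivAt.lim (EuclideanSpace.single i 1) hslim)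
    refine h1.congr fun n => ?_
    simp [b, mul_sub]
  -- Equal weights `s n` produce difference quotients. Those of `phi` are dominated by `G` through
  -- the mean value inequality; for `mPsi`, almost sure convergence to an integrable limit suffices.
  refine integral_limit_phi_eq_integral_limit_mPsi hMAR hcorrect k hbB hβ₀B s s
    (u := fun o => jacobian (fun β => phi M P β₀ o β γs ξs) β₀ k i) ?_ ?_ hG (fun n => ?_)
    (hN.integrable_mPsi k i)
  · filter_upwards [hN.ae_differentiableAt] with o ho
    refine hquot (f := fun β => phi M P β₀ o β γs ξs) ?_
    exact ((betaCLM p q).hasFDerivAt.comp β₀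
      (ho.hasFDerivAt.comp β₀ (hasFDerivAt_stack_left β₀ γs ξs))).differentiableAt
  · filter_upwards [hN.differentiable_mPsi] with o ho using hquot ho
  · filter_upwards [hC1, hle] with o hC1o hleo
    have h1 := (convex_ball (stack β₀ γs ξs) r).norm_image_sub_le_of_norm_fderiv_le (𝕜 := ℝ)
      (f := phiTilde M P β₀ o) (fun θ hθ => (hC1o.differentiableOn one_ne_zero).differentiableAt
        (hNo.mem_nhds (hrN hθ).1)) (fun θ hθ => hleo θ (hrN hθ).1) (Metric.mem_ball_self hr)
      (hball n)
    rw [hnorm, ← div_eq_mul_inv, le_div_iff₀ (hs n)] at h1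
    have h2 : ‖phi M P β₀ o (b n) γs ξs k - phi M P β₀ o β₀ γs ξs k‖
        ≤ ‖phiTilde M P β₀ o (stack (b n) γs ξs) - phiTilde M P β₀ o (stack β₀ γs ξs)‖ :=
      PiLp.norm_apply_le (p := 2) (phiTilde M P β₀ o (stack (b n) γs ξs)
        - phiTilde M P β₀ o (stack β₀ γs ξs)) (Sum.inl k)
    rw [← mul_sub, norm_mul, Real.norm_of_nonneg (hs n).le, mul_comm]
    exact (mul_le_mul_of_nonneg_right h2 (hs n).le).trans h1

theorem NormalityConditions.isUnit_expJacobian (hN : NormalityConditions M P β₀ γs ξs B) :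
    IsUnit (expJacobian P (phiTilde M P β₀) (stack β₀ γs ξs)).det := by
  have h := (Matrix.isUnit_iff_isUnit_det _).1 hN.nonsingular
  rw [Matrix.det_mul] at h
  exact isUnit_of_mul_isUnit_right h

/-- The determinant of a block triangular matrix is the product of those of its diagonal blocks, so
the inverses in the influence function are genuine. -/
theorem NormalityConditions.isUnit_blocks [IsProbabilityMeasure P]
    (hN : NormalityConditions M P β₀ γs ξs B) (hMAR : MissingAtRandom P)
    (hcorrect : PropensityCorrect M P γs ∨ OutcomeCorrect M P β₀ B ξs) :
    IsUnit (expJacobian P (mPsi M P β₀) β₀).det ∧ IsUnit (expJacobian P (obsMGamma M) γs).det ∧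
      IsUnit (expJacobian P (obsMXi M) ξs).det := by
  have h := hN.isUnit_expJacobian
  rw [expJacobian_phiTilde_eq_fromBlocks hN.ae_differentiableAt, Matrix.det_fromBlocks_zero₂₁,
    Matrix.det_fromBlocks_zero₂₁, hN.expJacobian_phi_eq hMAR hcorrect] at h
  exact ⟨isUnit_of_mul_isUnit_left h, isUnit_of_mul_isUnit_left (isUnit_of_mul_isUnit_right h),
    isUnit_of_mul_isUnit_right (isUnit_of_mul_isUnit_right h)⟩

/-- Solution of the block triangular linear system. -/
theorem NormalityConditions.inverse_apply_stack [IsProbabilityMeasure P]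
    (hN : NormalityConditions M P β₀ γs ξs B) (hMAR : MissingAtRandom P)
    (hcorrect : PropensityCorrect M P γs ∨ OutcomeCorrect M P β₀ B ξs)
    (u : Vec 2) (v : Vec p) (w : Vec q) :
    Matrix.toEuclideanCLM (𝕜 := ℝ) (expJacobian P (phiTilde M P β₀) (stack β₀ γs ξs))⁻¹
        (stack u v w) =
      stack (WithLp.toLp 2 ((expJacobian P (mPsi M P β₀) β₀)⁻¹.mulVec (u.ofLp
        - (expJacobian P (fun o γ => phi M P β₀ o β₀ γ ξs) γs).mulVec
            ((expJacobian P (obsMGamma M) γs)⁻¹.mulVec v.ofLp)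
        - (expJacobian P (fun o ξ => phi M P β₀ o β₀ γs ξ) ξs).mulVec
            ((expJacobian P (obsMXi M) ξs)⁻¹.mulVec w.ofLp))))
        (WithLp.toLp 2 ((expJacobian P (obsMGamma M) γs)⁻¹.mulVec v.ofLp))
        (WithLp.toLp 2 ((expJacobian P (obsMXi M) ξs)⁻¹.mulVec w.ofLp)) := by
  obtain ⟨hK, hDγ, hDξ⟩ := hN.isUnit_blocks hMAR hcorrect
  have hJ := hN.isUnit_expJacobian
  refine WithLp.ofLp_injective 2 ?_
  rw [Matrix.ofLp_toEuclideanCLM]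
  -- The inverse is verified rather than computed: multiply both sides by the Jacobian and check
  -- block by block.
  refine (Matrix.mulVec_injective_of_isUnit ((Matrix.isUnit_iff_isUnit_det _).2 hJ)) ?_
  rw [Matrix.mulVec_mulVec, Matrix.mul_nonsing_inv _ hJ, Matrix.one_mulVec,
    expJacobian_phiTilde_eq_fromBlocks hN.ae_differentiableAt,
    hN.expJacobian_phi_eq hMAR hcorrect]
  simp only [stack]
  rw [Matrix.fromBlocks_mulVec, Matrix.fromCols_mulVec, Matrix.fromBlocks_mulVec]
  simp only [Sum.elim_comp_inl, Sum.elim_comp_inr, Matrix.mulVec_mulVec, Matrix.zero_mul,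
    Matrix.zero_mulVec, zero_add, add_zero, Matrix.mul_nonsing_inv _ hK,
    Matrix.mul_nonsing_inv _ hDγ,
    Matrix.mul_nonsing_inv _ hDξ, Matrix.one_mulVec]
  congr 1
  abel

end Normality

/-! ### From minimizer to zero, and the limit law. -/

section AsymptoticNormality

variable {d p q : ℕ} {M : Ingredients d p q} {P : Measure (Obs d)} {β₀ : Vec 2}
  {γs : Vec p} {ξs : Vec q} {B : Set (Vec 2)}

theorem average_phiTilde (n : ℕ) (o : ℕ → Obs d) (θ : Theta p q) :
    (n : ℝ)⁻¹ • ∑ i ∈ Finset.range n, phiTilde M P β₀ (o i) θ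
      = stack ((n : ℝ)⁻¹ • ∑ i ∈ Finset.range n,
          phi M P β₀ (o i) (betaPart θ) (gammaPart θ) (xiPart θ))
        ((n : ℝ)⁻¹ • ∑ i ∈ Finset.range n, obsMGamma M (o i) (gammaPart θ))
        ((n : ℝ)⁻¹ • ∑ i ∈ Finset.range n, obsMXi M (o i) (xiPart θ)) := by
  have h : ∀ i, phiTilde M P β₀ (o i) θ = stackCLM p q
      (phi M P β₀ (o i) (betaPart θ) (gammaPart θ) (xiPart θ), obsMGamma M (o i) (gammaPart θ),
        obsMXi M (o i) (xiPart θ)) := fun i => rfl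
  simp_rw [h]
  rw [← map_sum, ← map_smul, stackCLM_apply]
  simp [Prod.fst_sum, Prod.snd_sum]

/-- A Newton step shows that a minimizer of the norm of a strictly differentiable function, along
directions containing the step, is a zero. -/
theorem eq_zero_of_norm_le_newton_step {E : Type*} [NormedAddCommGroup E] [NormedSpace ℝ E]
    {A : E → E} {θ : E} {L Linv : E →L[ℝ] E} (hinv : ∀ x, L (Linv x) = x) {η : ℝ}
    (hη : η * ‖Linv‖ ≤ 1 / 2) (hη0 : 0 ≤ η)
    (hstrict : ‖A (θ - Linv (A θ)) - A θ - L (θ - Linv (A θ) - θ)‖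
      ≤ η * ‖θ - Linv (A θ) - θ‖)
    (hmin : ‖A θ‖ ≤ ‖A (θ - Linv (A θ))‖) : A θ = 0 := by
  have h1 : θ - Linv (A θ) - θ = -Linv (A θ) := by abel
  rw [h1, map_neg, hinv, sub_neg_eq_add, sub_add_cancel, norm_neg] at hstrict
  have h2 : η * ‖Linv (A θ)‖ ≤ 1 / 2 * ‖A θ‖ := by
    calc η * ‖Linv (A θ)‖ ≤ η * (‖Linv‖ * ‖A θ‖) := by gcongr; exact Linv.le_opNorm _
      _ = η * ‖Linv‖ * ‖A θ‖ := by ring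
      _ ≤ 1 / 2 * ‖A θ‖ := by gcongr
  refine norm_le_zero_iff.1 ?_
  linarith

theorem NormalityConditions.influence_eq [IsProbabilityMeasure P]
    (hN : NormalityConditions M P β₀ γs ξs B) (hMAR : MissingAtRandom P)
    (hcorrect : PropensityCorrect M P γs ∨ OutcomeCorrect M P β₀ B ξs) (o : Obs d) :
    influence M P β₀ γs ξs o = -betaCLM p q
      (Matrix.toEuclideanCLM (𝕜 := ℝ) (expJacobian P (phiTilde M P β₀) (stack β₀ γs ξs))⁻¹
        (phiTilde M P β₀ o (stack β₀ γs ξs))) := by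
  rw [phiTilde, hN.inverse_apply_stack hMAR hcorrect]
  rfl

theorem NormalityConditions.inverse_apply_apply (hN : NormalityConditions M P β₀ γs ξs B)
    (x : Theta p q) :
    Matrix.toEuclideanCLM (𝕜 := ℝ) (expJacobian P (phiTilde M P β₀) (stack β₀ γs ξs))⁻¹
      (Matrix.toEuclideanCLM (𝕜 := ℝ) (expJacobian P (phiTilde M P β₀) (stack β₀ γs ξs)) x)
      = x := by
  rw [← mul_apply_eq_comp, ← map_mul, Matrix.nonsing_inv_mul _ hN.isUnit_expJacobian,
    map_one, one_apply_eq_self]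

theorem NormalityConditions.apply_inverse_apply (hN : NormalityConditions M P β₀ γs ξs B)
    (x : Theta p q) :
    Matrix.toEuclideanCLM (𝕜 := ℝ) (expJacobian P (phiTilde M P β₀) (stack β₀ γs ξs))
      (Matrix.toEuclideanCLM (𝕜 := ℝ) (expJacobian P (phiTilde M P β₀) (stack β₀ γs ξs))⁻¹ x)
      = x := by
  rw [← mul_apply_eq_comp, ← map_mul, Matrix.mul_nonsing_inv _ hN.isUnit_expJacobian,
    map_one, one_apply_eq_self]

theorem NormalityConditions.eventuallyLikely_average_strict {Ω : Type*} [MeasurableSpace Ω]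
    {Pr : Measure Ω} [IsProbabilityMeasure Pr] [IsProbabilityMeasure P]
    (hN : NormalityConditions M P β₀ γs ξs B)
    {O : ℕ → Ω → Obs d} (hlaw : ∀ i, HasLaw (O i) P Pr) (hindep : iIndepFun O Pr) {η : ℝ}
    (hη : 0 < η) :
    ∃ δ > 0, EventuallyLikely Pr fun n ω => ∀ θ ∈ Metric.ball (stack β₀ γs ξs) δ,
      ∀ θ' ∈ Metric.ball (stack β₀ γs ξs) δ,
        ‖(n : ℝ)⁻¹ • ∑ i ∈ Finset.range n, phiTilde M P β₀ (O i ω) θ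
          - (n : ℝ)⁻¹ • ∑ i ∈ Finset.range n, phiTilde M P β₀ (O i ω) θ'
          - Matrix.toEuclideanCLM (𝕜 := ℝ) (expJacobian P (phiTilde M P β₀) (stack β₀ γs ξs))
            (θ - θ')‖ ≤ η * ‖θ - θ'‖ := by
  obtain ⟨N, hNo, hmem, hC1, G, hG, hle⟩ := hN.smooth
  rw [toEuclideanCLM_expJacobian hN.integrable_fderiv_phiTilde]
  exact eventuallyLikely_average_strict_fderiv hlaw hindep measurable_phiTilde hNo hmem hC1 hG
    hle hη

/-- The minimizer solves the estimating equations with probability tending to one. -/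
theorem NormalityConditions.eventuallyLikely_average_eq_zero {Ω : Type*} [MeasurableSpace Ω]
    {Pr : Measure Ω} [IsProbabilityMeasure Pr] [IsProbabilityMeasure P]
    (hN : NormalityConditions M P β₀ γs ξs B)
    {O : ℕ → Ω → Obs d} (hlaw : ∀ i, HasLaw (O i) P Pr) (hindep : iIndepFun O Pr)
    (hMAR : MissingAtRandom P)
    {γhat : ℕ → Ω → Vec p} {ξhat : ℕ → Ω → Vec q} {βhat : ℕ → Ω → Vec 2}
    (hβhat : EventuallyLikely Pr fun n ω => βhat n ω ∈ B ∧ ∀ β ∈ B,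
      Qhat M P β₀ n (fun i => O i ω) (βhat n ω) (γhat n ω) (ξhat n ω) ≤
        Qhat M P β₀ n (fun i => O i ω) β (γhat n ω) (ξhat n ω))
    (hcorrect : PropensityCorrect M P γs ∨ OutcomeCorrect M P β₀ B ξs)
    (hθlim : ∀ ε > 0, EventuallyLikely Pr fun n ω =>
      ‖stack (βhat n ω) (γhat n ω) (ξhat n ω) - stack β₀ γs ξs‖ < ε)
    (hγeq : EventuallyLikely Pr
      (fun n ω => ∑ i ∈ Finset.range n, obsMGamma M (O i ω) (γhat n ω) = 0))
    (hξeq : EventuallyLikely Pr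
      (fun n ω => ∑ i ∈ Finset.range n, obsMXi M (O i ω) (ξhat n ω) = 0)) :
    EventuallyLikely Pr fun n ω => (n : ℝ)⁻¹ • ∑ i ∈ Finset.range n,
      phiTilde M P β₀ (O i ω) (stack (βhat n ω) (γhat n ω) (ξhat n ω)) = 0 := by
  set θ₀ : Theta p q := stack β₀ γs ξs with hθ₀
  let A : ℕ → Ω → Theta p q → Theta p q := fun n ω θ =>
    (n : ℝ)⁻¹ • ∑ i ∈ Finset.range n, phiTilde M P β₀ (O i ω) θ
  let θhat : ℕ → Ω → Theta p q := fun n ω => stack (βhat n ω) (γhat n ω) (ξhat n ω)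
  let L : Theta p q →L[ℝ] Theta p q :=
    Matrix.toEuclideanCLM (𝕜 := ℝ) (expJacobian P (phiTilde M P β₀) θ₀)
  let Linv : Theta p q →L[ℝ] Theta p q :=
    Matrix.toEuclideanCLM (𝕜 := ℝ) (expJacobian P (phiTilde M P β₀) θ₀)⁻¹
  have hA₀ : ∀ ε > 0, EventuallyLikely Pr fun n ω => ‖A n ω θ₀‖ < ε := by
    intro ε hε
    have := eventuallyLikely_average hlaw hindep (hN.second_moment.integrable (by norm_num)) hε
    simpa [hN.mean_zero, A] using this
  change EventuallyLikely Pr fun n ω => A n ω (θhat n ω) = 0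
  -- With this `η` a Newton step at least halves the norm of the average.
  set η : ℝ := 1 / (2 * (‖Linv‖ + 1)) with hη
  have hηpos : 0 < η := by positivity
  have hηle : η * ‖Linv‖ ≤ 1 / 2 := by
    rw [hη, div_mul_eq_mul_div, one_mul, div_le_div_iff₀ (by positivity) (by norm_num)]
    linarith
  obtain ⟨δ, hδ, hst⟩ := hN.eventuallyLikely_average_strict hlaw hindep hηpos
  obtain ⟨r, hr, hrB⟩ := Metric.isOpen_iff.1 isOpen_interior θ₀ hN.interior_mem
  set ρ : ℝ := min δ r with hρ
  have hρpos : 0 < ρ := lt_min hδ hr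
  set τ : ℝ := ρ / (2 * (‖Linv‖ + 1)) with hτ
  have hτpos : 0 < τ := by positivity
  -- The first bound leaves room `ρ / 2` for the Newton step. The second, with `‖A n ω θ₀‖ < τ / 2`,
  -- gives `‖a‖ < τ`, and `τ` is chosen so that the step is shorter than `ρ / 2`.
  have hclose := hθlim (min (ρ / 2) (τ / (2 * (‖L‖ + η)))) (by positivity)
  refine ((hst.and hclose).and ((hA₀ (τ / 2) (by positivity)).and
    (hβhat.and (hγeq.and hξeq)))).mono
    (Eventually.of_forall fun n => ae_of_all _ fun ω => ?_)
  rintro ⟨⟨hs, hc⟩, h0, ⟨-, hmin⟩, hγ0, hξ0⟩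
  rw [lt_min_iff] at hc
  have hmemδ : θhat n ω ∈ Metric.ball θ₀ δ := by
    rw [Metric.mem_ball, dist_eq_norm]
    linarith [min_le_left δ r, hc.1]
  set a := A n ω (θhat n ω) with ha
  have hstack : a = stack ((n : ℝ)⁻¹ • ∑ i ∈ Finset.range n,
      phi M P β₀ (O i ω) (βhat n ω) (γhat n ω) (ξhat n ω)) 0 0 := by
    simp only [ha, A]
    rw [average_phiTilde]
    simp [θhat, hγ0, hξ0]
  have hsmall : ‖a‖ < τ := by
    have h1 := hs _ hmemδ θ₀ (Metric.mem_ball_self hδ)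
    have h2 : ‖a‖ ≤ ‖a - A n ω θ₀ - L (θhat n ω - θ₀)‖ + ‖L (θhat n ω - θ₀)‖ + ‖A n ω θ₀‖ := by
      have := norm_add₃_le (a := a - A n ω θ₀ - L (θhat n ω - θ₀)) (b := L (θhat n ω - θ₀))
        (c := A n ω θ₀)
      simpa using this
    have h3 := L.le_opNorm (θhat n ω - θ₀)
    have h4 : (‖L‖ + η) * ‖θhat n ω - θ₀‖ < τ / 2 := by
      have := hc.2
      rw [lt_div_iff₀ (by positivity)] at this
      linarith
    linarith
  have hstep : ‖Linv a‖ < ρ / 2 := by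
    refine (Linv.le_opNorm a).trans_lt ?_
    calc ‖Linv‖ * ‖a‖ ≤ (‖Linv‖ + 1) * ‖a‖ := by gcongr; linarith
      _ < (‖Linv‖ + 1) * τ := by gcongr
      _ = ρ / 2 := by rw [hτ]; field_simp
  have hnew : ‖θhat n ω - Linv a - θ₀‖ < ρ := by
    have : θhat n ω - Linv a - θ₀ = (θhat n ω - θ₀) - Linv a := by abel
    rw [this]
    refine (norm_sub_le _ _).trans_lt ?_
    linarith [hc.1]
  have hnewδ : θhat n ω - Linv a ∈ Metric.ball θ₀ δ := by
    rw [Metric.mem_ball, dist_eq_norm]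
    exact hnew.trans_le (min_le_left _ _)
  have hnewB : betaPart (θhat n ω - Linv a) ∈ B := by
    have : θhat n ω - Linv a ∈ Metric.ball θ₀ r := by
      rw [Metric.mem_ball, dist_eq_norm]
      exact hnew.trans_le (min_le_right _ _)
    have hInt := interior_subset (hrB this)
    exact hInt
  -- As the nuisance equations hold, `a` has only a `β` block, and by triangularity so has the
  -- Newton step. The new point keeps the estimated nuisance parameters, so minimality of `βhat`
  -- applies to it.
  have hinvstack := hN.inverse_apply_stack hMAR hcorrect ((n : ℝ)⁻¹ • ∑ i ∈ Finset.range n,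
      phi M P β₀ (O i ω) (βhat n ω) (γhat n ω) (ξhat n ω)) 0 0
  rw [← hstack] at hinvstack
  have hγnew : gammaPart (θhat n ω - Linv a) = γhat n ω := by
    have h1 : gammaPart (Linv a) = 0 := by
      refine (congrArg gammaPart hinvstack).trans ?_
      simp
    rw [← gammaCLM_apply, map_sub, gammaCLM_apply, gammaCLM_apply, h1, sub_zero]
    rfl
  have hξnew : xiPart (θhat n ω - Linv a) = ξhat n ω := by
    have h1 : xiPart (Linv a) = 0 := by
      refine (congrArg xiPart hinvstack).trans ?_
      simp
    rw [← xiCLM_apply, map_sub, xiCLM_apply, xiCLM_apply, h1, sub_zero]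
    rfl
  refine eq_zero_of_norm_le_newton_step (A := A n ω) hN.apply_inverse_apply hηle hηpos.le
    (hs _ hnewδ _ hmemδ) ?_
  rw [← ha]
  have hle := norm_average_le_of_Qhat_le (hmin _ hnewB)
  rw [hstack, norm_stack_zero_zero, ← hstack]
  refine hle.trans (le_of_eq_of_le ?_ (norm_betaPart_le (A n ω (θhat n ω - Linv a))))
  simp only [A]
  rw [average_phiTilde, betaPart_stack, hγnew, hξnew]

set_option maxHeartbeats 800000 in
theorem NormalityConditions.tendstoInDistribution {Ω : Type*} [MeasurableSpace Ω]
    {Pr : Measure Ω} [IsProbabilityMeasure Pr] [IsProbabilityMeasure P]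
    (hN : NormalityConditions M P β₀ γs ξs B)
    {O : ℕ → Ω → Obs d} (hlaw : ∀ i, HasLaw (O i) P Pr) (hindep : iIndepFun O Pr)
    (hMAR : MissingAtRandom P)
    {γhat : ℕ → Ω → Vec p} {ξhat : ℕ → Ω → Vec q} {βhat : ℕ → Ω → Vec 2}
    (hβmeas : ∀ n, AEMeasurable (βhat n) Pr)
    (hβhat : EventuallyLikely Pr fun n ω => βhat n ω ∈ B ∧ ∀ β ∈ B,
      Qhat M P β₀ n (fun i => O i ω) (βhat n ω) (γhat n ω) (ξhat n ω) ≤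
        Qhat M P β₀ n (fun i => O i ω) β (γhat n ω) (ξhat n ω))
    (hγlim : TendstoInMeasure Pr γhat atTop fun _ => γs)
    (hξlim : TendstoInMeasure Pr ξhat atTop fun _ => ξs)
    (hcorrect : PropensityCorrect M P γs ∨ OutcomeCorrect M P β₀ B ξs)
    (hβlim : TendstoInMeasure Pr βhat atTop fun _ => β₀)
    (hγeq : EventuallyLikely Pr
      (fun n ω => ∑ i ∈ Finset.range n, obsMGamma M (O i ω) (γhat n ω) = 0))
    (hξeq : EventuallyLikely Pr
      (fun n ω => ∑ i ∈ Finset.range n, obsMXi M (O i ω) (ξhat n ω) = 0)) :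
    TendstoInDistribution (fun (n : ℕ) ω => Real.sqrt n • (βhat n ω - β₀)) atTop id
      (fun _ => Pr) (multivariateGaussian 0 (asymptoticVariance M P β₀ γs ξs)) := by
  set θ₀ : Theta p q := stack β₀ γs ξs with hθ₀
  let A : ℕ → Ω → Theta p q → Theta p q := fun n ω θ =>
    (n : ℝ)⁻¹ • ∑ i ∈ Finset.range n, phiTilde M P β₀ (O i ω) θ
  let θhat : ℕ → Ω → Theta p q := fun n ω => stack (βhat n ω) (γhat n ω) (ξhat n ω)
  let L : Theta p q →L[ℝ] Theta p q :=
    Matrix.toEuclideanCLM (𝕜 := ℝ) (expJacobian P (phiTilde M P β₀) θ₀)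
  let Linv : Theta p q →L[ℝ] Theta p q :=
    Matrix.toEuclideanCLM (𝕜 := ℝ) (expJacobian P (phiTilde M P β₀) θ₀)⁻¹
  have hθlim : ∀ ε > 0, EventuallyLikely Pr fun n ω => ‖θhat n ω - θ₀‖ < ε := by
    intro ε hε
    have hε3 : 0 < ε / 3 := by positivity
    refine ((eventuallyLikely_norm_sub_lt hβlim hε3).and
      ((eventuallyLikely_norm_sub_lt hγlim hε3).and
        (eventuallyLikely_norm_sub_lt hξlim hε3))).mono
      (Eventually.of_forall fun n => ae_of_all _ fun ω => ?_)
    rintro ⟨h1, h2, h3⟩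
    simp only [θhat, hθ₀]
    rw [stack_sub_stack]
    refine (norm_stack_le _ _ _).trans_lt ?_
    linarith
  have hzero := hN.eventuallyLikely_average_eq_zero hlaw hindep hMAR hβhat hcorrect hθlim hγeq hξeq
  have hclt : TendstoInDistribution (fun (n : ℕ) ω => Real.sqrt n • A n ω θ₀) atTop id
      (fun _ => Pr) _ :=
    tendstoInDistribution_sqrt_smul_average hlaw hindep hN.second_moment hN.mean_zero
  have hlin := tendstoInMeasure_linearization (A := A) (L := L) (Linv := Linv)
    hN.inverse_apply_apply (fun η hη => hN.eventuallyLikely_average_strict hlaw hindep hη) hθlim hzero hclt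
  -- The influence function is a fixed linear image of the stacked function at `θ₀`, and so inherits
  -- mean zero and finite second moments.
  let T : Theta p q →L[ℝ] Vec 2 := -(betaCLM p q).comp Linv
  have hIF : influence M P β₀ γs ξs = fun o => T (phiTilde M P β₀ o θ₀) := by
    funext o
    exact hN.influence_eq hMAR hcorrect o
  have hIFmem : MemLp (influence M P β₀ γs ξs) 2 P := by
    rw [hIF]
    exact hN.second_moment.continuousLinearMap_comp T
  have hIF0 : ∫ o, influence M P β₀ γs ξs o ∂P = 0 := by
    rw [hIF, T.integral_comp_comm (hN.second_moment.integrable (by norm_num)), hN.mean_zero,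
      map_zero]
  -- Slutsky: the normalized error differs from the normalized average of influence functions by the
  -- `β` block of the linearization remainder.
  refine tendstoInDistribution_of_tendstoInMeasure_sub _ _
    (tendstoInDistribution_sqrt_smul_average hlaw hindep hIFmem hIF0) ?_ fun n => ?_
  · refine tendstoInMeasure_of_eventuallyLikely (c := 0) fun ε hε => ?_
    refine (eventuallyLikely_norm_sub_lt hlin hε).mono
      (Eventually.of_forall fun n => ae_of_all _ fun ω h => ?_)
    rw [sub_zero] at h ⊢
    refine lt_of_le_of_lt (le_of_eq_of_le (congrArg norm ?_) (norm_betaPart_le _)) h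
    have h1 : ∑ i ∈ Finset.range n, influence M P β₀ γs ξs (O i ω)
        = T (∑ i ∈ Finset.range n, phiTilde M P β₀ (O i ω) θ₀) := by
      rw [hIF, map_sum]
    have h2 : (n : ℝ)⁻¹ • ∑ i ∈ Finset.range n, influence M P β₀ γs ξs (O i ω)
        = T (A n ω θ₀) := by rw [h1, ← map_smul]
    have h3 : T (A n ω θ₀) = -betaCLM p q (Linv (A n ω θ₀)) := rfl
    have h4 : betaCLM p q (θhat n ω - θ₀) = βhat n ω - β₀ := by
      rw [map_sub]
      rfl
    have h5 : ∀ y, betaCLM p q (Real.sqrt n • (θhat n ω - θ₀) + Linv (Real.sqrt n • y))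
        = Real.sqrt n • (βhat n ω - β₀) + Real.sqrt n • betaCLM p q (Linv y) := fun y => by
      rw [map_add, map_smul, h4, map_smul, map_smul]
    change Real.sqrt n • (βhat n ω - β₀) - Real.sqrt n • ((n : ℝ)⁻¹ • ∑ i ∈ Finset.range n,
      influence M P β₀ γs ξs (O i ω)) = betaCLM p q (Real.sqrt n • (θhat n ω - θ₀)
        + Linv (Real.sqrt n • A n ω θ₀))
    rw [h2, h3, smul_neg, sub_neg_eq_add, h5]
  · have := hβmeas n
    fun_prop

end AsymptoticNormality

end RobustAIPW

open RobustAIPW in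
theorem proposition2 {d p q : ℕ} {Ω : Type*} [MeasurableSpace Ω]
    (Pr : Measure Ω) [IsProbabilityMeasure Pr]
    (P : Measure (Obs d)) [IsProbabilityMeasure P]
    -- the sample: i.i.d. with law `P`, outcomes missing at random
    (O : ℕ → Ω → Obs d) (hlaw : ∀ i, HasLaw (O i) P Pr) (hindep : iIndepFun O Pr)
    (hMAR : MissingAtRandom P)
    -- working models, estimating functions, parameter space of `(μ, σ)`, true and limit values
    (M : Ingredients d p q) (B : Set (Vec 2)) (hB : ∀ β ∈ B, 0 < β 1)
    (β₀ : Vec 2) (γs : Vec p) (ξs : Vec q)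
    -- the estimators
    (γhat : ℕ → Ω → Vec p) (ξhat : ℕ → Ω → Vec q) (βhat : ℕ → Ω → Vec 2)
    (hγmeas : ∀ n, AEMeasurable (γhat n) Pr) (hξmeas : ∀ n, AEMeasurable (ξhat n) Pr)
    (hβmeas : ∀ n, AEMeasurable (βhat n) Pr)
    (hβhat : EventuallyLikely Pr fun n ω => βhat n ω ∈ B ∧ ∀ β ∈ B,
      Qhat M P β₀ n (fun i => O i ω) (βhat n ω) (γhat n ω) (ξhat n ω) ≤
        Qhat M P β₀ n (fun i => O i ω) β (γhat n ω) (ξhat n ω))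
    (hγlim : TendstoInMeasure Pr γhat atTop fun _ => γs)
    (hξlim : TendstoInMeasure Pr ξhat atTop fun _ => ξs)
    -- at least one of the two models is correctly specified
    (hcorrect : PropensityCorrect M P γs ∨ OutcomeCorrect M P β₀ B ξs) :
    (ConsistencyConditions M P β₀ γs ξs B → TendstoInMeasure Pr βhat atTop fun _ => β₀) ∧
    (TendstoInMeasure Pr βhat atTop (fun _ => β₀) →
      EventuallyLikely Pr
        (fun n ω => ∑ i ∈ Finset.range n, obsMGamma M (O i ω) (γhat n ω) = 0) →
      EventuallyLikely Pr
        (fun n ω => ∑ i ∈ Finset.range n, obsMXi M (O i ω) (ξhat n ω) = 0) →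
      NormalityConditions M P β₀ γs ξs B →
      TendstoInDistribution (fun (n : ℕ) ω => Real.sqrt n • (βhat n ω - β₀)) atTop id
        (fun _ => Pr) (multivariateGaussian 0 (asymptoticVariance M P β₀ γs ξs))) := by
  refine ⟨fun hC => hC.tendstoInMeasure hlaw hindep hMAR hβhat hγlim hξlim hcorrect,
    fun hβlim hγeq hξeq hN => ?_⟩
  exact hN.tendstoInDistribution hlaw hindep hMAR hβmeas hβhat hγlim hξlim hcorrect hβlim hγeq hξeq
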